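/- Let $k=\mathbb R$ or $\mathbb C$, let $q\in k$ be non-zero and not a root of unity, and let $s\in[0,1]$. Let $P=SU_q(2)$ be the algebra generated by $\alpha,\beta,\gamma,\delta$ with relations $\alpha\beta=q\beta\alpha$, $\alpha\gamma=q\gamma\alpha$, $\beta\gamma=\gamma\beta$, $\beta\delta=q\delta\beta$, $\gamma\delta=q\delta\gamma$, $\alpha\delta=\delta\alpha+(q-q^{-1})\beta\gamma$, $\alpha\delta-q\beta\gamma=1$, with the matrix coproduct $\Delta$ and counit. Let $B=S^2_{qs}\subseteq P$ be the subalgebra generated by $$\xi=s(\alpha^2-q^{-1}\beta^2)+(s^2-1)q^{-1}\alpha\beta,\quad \eta=s(q\gamma^2-\delta^2)+(s^2-1)\gamma\delta,\quad \zeta=s(q\alpha\gamma-\beta\delta)+(s^2-1)q\beta\gamma .$$ Let $C_s=P/J_s$ with $J_s=\{\xi-s,\eta+s,\zeta\}P$, with projection $\pi_s$ and the induced coalgebra structure, coacting on $P$ by $\Delta_P=(\mathrm{id}\otimes\pi_s)\Delta$. Let $V=k$ with the left coaction $1\mapsto\pi_s(\alpha+s\beta)\otimes 1$. Put $$E_s=\{x(\alpha+s\beta)+y(\gamma+s\delta)\mid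 x,y\in B\},\qquad e_s=\frac1{1+s^2}\begin{pmatrix}1-\zeta&\xi\\-\eta&s^2+q^{-2}\zeta\end{pmatrix},$$ and let $E'_s=\{z\in P\otimes V\mid(\Delta_P\otimes\mathrm{id})z=(\mathrm{id}\otimes{}_V\Delta)z\}$ be the left $B$-module associated to $P$ and $V$. Then: 1. There is exactly one linear functional $\tau^1:B\to k$ with $\tau^1(xy)=\tau^1(yx)$ for all $x,y$ (a cyclic $0$-cocycle), $\tau^1(1)=0$, $\tau^1(\zeta^n)=\dfrac{1-(-s^2)^n}{1-q^{-2n}}$ for $n\ge1$, and $\tau^1(\zeta^n\xi^m)=\tau^1(\zeta^n\eta^m)=0$ for $n\ge0$, $m\ge1$. In particular $\tau^1(\zeta)=\dfrac{1+s^2}{1-q^{-2}}$. 2. $e_s^2=e_s$, the left $B$-module $B^2e_s$ is isomorphic to $E_s$, and the Chern number (monopole charge) is $\mathrm{ch}(E_s)=\tau^1(\mathrm{tr}\,e_s)=-1$ for every $s$. It does not depend on the projector: $\tau^1(\mathrm{tr} f)=-1$ for every idempotent $f\in M_n(B)$ with $B^nf\cong E_s$. 3. $p\otimes1\in E'_s$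 for every $p\in E_s$, and neither $E_s$ nor $E'_s$ is isomorphic to $B\otimes V$ as a left $B$-module. 4. $SU_q(2)$ is not isomorphic to $B\otimes C_s$ as a left $B$-module and right $C_s$-comodule, i.e. the coalgebra Hopf bundle $SU_q(2)(S^2_{qs})^{C_s}$ is not cleft (is non-trivial). -/

import Mathlib

open scoped TensorProduct

set_option linter.unusedSimpArgs false
set_option linter.unnecessarySeqFocus false
set_option linter.unreachableTactic false
set_option linter.unusedTactic false

noncomputable section

namespace QSphere

/-! ### The quantum group `SU_q(2)` -/

/-- Names of the four matrix generators. -/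
inductive Gen where
  | α | β | γ | δ

/-- The defining relations of `SU_q(2)`. -/
inductive Rel {k : Type*} [Field k] (q : kˣ) :
    FreeAlgebra k Gen → FreeAlgebra k Gen → Prop
  | αβ : Rel q (FreeAlgebra.ι k .α * FreeAlgebra.ι k .β)
      ((q : k) • (FreeAlgebra.ι k .β * FreeAlgebra.ι k .α))
  | αγ : Rel q (FreeAlgebra.ι k .α * FreeAlgebra.ι k .γ)
      ((q : k) • (FreeAlgebra.ι k .γ * FreeAlgebra.ι k .α))
  | βγ : Rel q (FreeAlgebra.ι k .β * FreeAlgebra.ι k .γ)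
      (FreeAlgebra.ι k .γ * FreeAlgebra.ι k .β)
  | βδ : Rel q (FreeAlgebra.ι k .β * FreeAlgebra.ι k .δ)
      ((q : k) • (FreeAlgebra.ι k .δ * FreeAlgebra.ι k .β))
  | γδ : Rel q (FreeAlgebra.ι k .γ * FreeAlgebra.ι k .δ)
      ((q : k) • (FreeAlgebra.ι k .δ * FreeAlgebra.ι k .γ))
  | αδ : Rel q (FreeAlgebra.ι k .α * FreeAlgebra.ι k .δ)
      (FreeAlgebra.ι k .δ * FreeAlgebra.ι k .α
        + ((q : k) - (q : k)⁻¹) • (FreeAlgebra.ι k .β * FreeAlgebra.ι k .γ))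
  | det : Rel q (FreeAlgebra.ι k .α * FreeAlgebra.ι k .δ
        - (q : k) • (FreeAlgebra.ι k .β * FreeAlgebra.ι k .γ)) 1

/-- The algebra `SU_q(2)`: generators `α, β, γ, δ` and the relations `Rel q`. -/
def SUq {k : Type*} [Field k] (q : kˣ) : Type _ := RingQuot (Rel q)

instance {k : Type*} [Field k] (q : kˣ) : Ring (SUq q) :=
  inferInstanceAs (Ring (RingQuot (Rel q)))

instance {k : Type*} [Field k] (q : kˣ) : Algebra k (SUq q) :=
  inferInstanceAs (Algebra k (RingQuot (Rel q)))

namespace SUq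

/-- The quotient map from the free algebra onto `SU_q(2)`. -/
def mk {k : Type*} [Field k] (q : kˣ) : FreeAlgebra k Gen →ₐ[k] SUq q :=
  RingQuot.mkAlgHom k (Rel q)

lemma mk_rel {k : Type*} [Field k] (q : kˣ) {x y : FreeAlgebra k Gen} (h : Rel q x y) :
    mk q x = mk q y := RingQuot.mkAlgHom_rel k h

/-- The generators of `SU_q(2)`. -/
def gen {k : Type*} [Field k] (q : kˣ) (g : Gen) : SUq q := mk q (FreeAlgebra.ι k g)

abbrev α {k : Type*} [Field k] (q : kˣ) : SUq q := gen q .α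
abbrev β {k : Type*} [Field k] (q : kˣ) : SUq q := gen q .β
abbrev γ {k : Type*} [Field k] (q : kˣ) : SUq q := gen q .γ
abbrev δ {k : Type*} [Field k] (q : kˣ) : SUq q := gen q .δ

section
variable {k : Type*} [Field k] (q : kˣ)

lemma rel_αβ : α q * β q = (q : k) • (β q * α q) := by
  simpa [gen] using mk_rel q (Rel.αβ (q := q))
lemma rel_αγ : α q * γ q = (q : k) • (γ q * α q) := by
  simpa [gen] using mk_rel q (Rel.αγ (q := q))
lemma rel_βγ : β q * γ q = γ q * β q := by
  simpa [gen] using mk_rel q (Rel.βγ (q := q))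
lemma rel_βδ : β q * δ q = (q : k) • (δ q * β q) := by
  simpa [gen] using mk_rel q (Rel.βδ (q := q))
lemma rel_γδ : γ q * δ q = (q : k) • (δ q * γ q) := by
  simpa [gen] using mk_rel q (Rel.γδ (q := q))
lemma rel_αδ : α q * δ q = δ q * α q + ((q : k) - (q : k)⁻¹) • (β q * γ q) := by
  simpa [gen] using mk_rel q (Rel.αδ (q := q))
lemma rel_det : α q * δ q - (q : k) • (β q * γ q) = 1 := by
  simpa [gen] using mk_rel q (Rel.det (q := q))

lemma βα : β q * α q = (q : k)⁻¹ • (α q * β q) := by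
  rw [rel_αβ, smul_smul, inv_mul_cancel₀ q.ne_zero, one_smul]
lemma γα : γ q * α q = (q : k)⁻¹ • (α q * γ q) := by
  rw [rel_αγ, smul_smul, inv_mul_cancel₀ q.ne_zero, one_smul]
lemma γβ : γ q * β q = β q * γ q := (rel_βγ q).symm
lemma δβ : δ q * β q = (q : k)⁻¹ • (β q * δ q) := by
  rw [rel_βδ, smul_smul, inv_mul_cancel₀ q.ne_zero, one_smul]
lemma δγ : δ q * γ q = (q : k)⁻¹ • (γ q * δ q) := by
  rw [rel_γδ, smul_smul, inv_mul_cancel₀ q.ne_zero, one_smul]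
lemma αδ : α q * δ q = 1 + (q : k) • (β q * γ q) := sub_eq_iff_eq_add.1 (rel_det q)
lemma δα : δ q * α q = 1 + (q : k)⁻¹ • (β q * γ q) := by
  have h := rel_αδ q
  rw [αδ, sub_smul] at h
  rw [eq_sub_of_add_eq h.symm]
  abel

/-- The universal property of `SU_q(2)`. -/
def lift {A : Type*} [Ring A] [Algebra k A] (f : FreeAlgebra k Gen →ₐ[k] A)
    (h : ∀ ⦃x y⦄, Rel q x y → f x = f y) : SUq q →ₐ[k] A :=
  RingQuot.liftAlgHom k ⟨f, h⟩

lemma lift_gen {A : Type*} [Ring A] [Algebra k A] (f : FreeAlgebra k Gen →ₐ[k] A)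
    (h : ∀ ⦃x y⦄, Rel q x y → f x = f y) (g : Gen) :
    lift q f h (gen q g) = f (FreeAlgebra.ι k g) :=
  RingQuot.liftAlgHom_mkAlgHom_apply k f h _

lemma algHom_ext {A : Type*} [Semiring A] [Algebra k A] {f f' : SUq q →ₐ[k] A}
    (h : ∀ g, f (gen q g) = f' (gen q g)) : f = f' := by
  refine RingQuot.ringQuot_ext' (S := k) (s := Rel q) f f' ?_
  apply FreeAlgebra.hom_ext
  funext g
  exact h g

end

/-- Values of the coproduct on generators: `Δ(t_{ik}) = ∑_j t_{ij} ⊗ t_{jk}`. -/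
def comulGen {k : Type*} [Field k] (q : kˣ) : Gen → SUq q ⊗[k] SUq q
  | .α => α q ⊗ₜ α q + β q ⊗ₜ γ q
  | .β => α q ⊗ₜ β q + β q ⊗ₜ δ q
  | .γ => γ q ⊗ₜ α q + δ q ⊗ₜ γ q
  | .δ => γ q ⊗ₜ β q + δ q ⊗ₜ δ q

/-- Values of the counit on generators: the identity matrix. -/
def counitGen (k : Type*) [Field k] : Gen → k
  | .α => 1
  | .β => 0
  | .γ => 0
  | .δ => 1

section
variable {k : Type*} [Field k] (q : kˣ)

lemma comul_rel ⦃x y : FreeAlgebra k Gen⦄ (h : Rel q x y) :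
    FreeAlgebra.lift k (comulGen q) x = FreeAlgebra.lift k (comulGen q) y := by
  have hq : (q : k) ≠ 0 := q.ne_zero
  cases h <;>
  simp only [map_mul, map_smul, map_add, map_sub, map_one, FreeAlgebra.lift_ι_apply, comulGen,
    add_mul, mul_add, Algebra.TensorProduct.tmul_mul_tmul, βα, γα, γβ, δβ, δγ, αδ, δα,
    TensorProduct.tmul_add, TensorProduct.add_tmul, TensorProduct.tmul_smul,
    ← TensorProduct.smul_tmul', Algebra.TensorProduct.one_def] <;>
  match_scalars <;> field_simp <;> ring

lemma counit_rel ⦃x y : FreeAlgebra k Gen⦄ (h : Rel q x y) :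
    FreeAlgebra.lift k (counitGen k) x = FreeAlgebra.lift k (counitGen k) y := by
  cases h <;> simp [counitGen]

/-- The coproduct of `SU_q(2)` as an algebra map. -/
def comulHom : SUq q →ₐ[k] SUq q ⊗[k] SUq q :=
  lift q (FreeAlgebra.lift k (comulGen q)) (comul_rel q)

/-- The counit of `SU_q(2)` as an algebra map. -/
def counitHom : SUq q →ₐ[k] k :=
  lift q (FreeAlgebra.lift k (counitGen k)) (counit_rel q)

lemma comulHom_gen (g : Gen) : comulHom q (gen q g) = comulGen q g := by
  simp [comulHom, lift_gen]

lemma counitHom_gen (g : Gen) : counitHom q (gen q g) = counitGen k g := by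
  simp [counitHom, lift_gen]

/-- The bialgebra `SU_q(2)`. -/
instance : Bialgebra k (SUq q) :=
  Bialgebra.ofAlgHom (comulHom q) (counitHom q)
    (algHom_ext q fun g => by
      cases g <;>
      simp [comulHom_gen, comulGen, TensorProduct.add_tmul, TensorProduct.tmul_add] <;> abel)
    (algHom_ext q fun g => by
      cases g <;> simp [comulHom_gen, comulGen, counitHom_gen, counitGen])
    (algHom_ext q fun g => by
      cases g <;> simp [comulHom_gen, comulGen, counitHom_gen, counitGen])

lemma comul_eq (x : SUq q) : Coalgebra.comul (R := k) x = comulHom q x := rfl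
lemma counit_eq (x : SUq q) : Coalgebra.counit (R := k) x = counitHom q x := rfl

end

end SUq

open SUq

/-! ### The quantum spheres -/

section
variable {k : Type*} [Field k] (q : kˣ) (s : k)

/-- The generator `ξ` of the quantum sphere, as an element of `SU_q(2)`. -/
def ξ : SUq q :=
  s • (α q ^ 2 - (q : k)⁻¹ • β q ^ 2) + ((s ^ 2 - 1) * (q : k)⁻¹) • (α q * β q)

/-- The generator `η` of the quantum sphere, as an element of `SU_q(2)`. -/
def η : SUq q :=
  s • ((q : k) • γ q ^ 2 - δ q ^ 2) + (s ^ 2 - 1) • (γ q * δ q)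

/-- The generator `ζ` of the quantum sphere, as an element of `SU_q(2)`. -/
def ζ : SUq q :=
  s • ((q : k) • (α q * γ q) - β q * δ q) + ((s ^ 2 - 1) * (q : k)) • (β q * γ q)

/-- The quantum two-sphere `S²_{qs}`: the subalgebra of `SU_q(2)` generated by `ξ, η, ζ`. -/
def sphere : Subalgebra k (SUq q) := Algebra.adjoin k {ξ q s, η q s, ζ q s}

/-- `ξ` as an element of the sphere. -/
def sξ : sphere q s := ⟨ξ q s, Algebra.subset_adjoin (by simp)⟩
/-- `η` as an element of the sphere. -/
def sη : sphere q s := ⟨η q s, Algebra.subset_adjoin (by simp)⟩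
/-- `ζ` as an element of the sphere. -/
def sζ : sphere q s := ⟨ζ q s, Algebra.subset_adjoin (by simp)⟩

/-! ### The structure coalgebra `C_s` and the coaction -/

/-- The right ideal `J_s = {ξ - s, η + s, ζ} SU_q(2)`. -/
def J : Submodule k (SUq q) :=
  Submodule.span k {x | ∃ b ∈ ({ξ q s - algebraMap k _ s, η q s + algebraMap k _ s, ζ q s} :
    Set (SUq q)), ∃ p, x = b * p}

/-- The quotient `C_s = SU_q(2) / J_s`. -/
abbrev C : Type _ := SUq q ⧸ J q s

/-- The canonical projection `π_s`. -/
def π : SUq q →ₗ[k] C q s := (J q s).mkQ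

/-- The right coaction `(id ⊗ π_s) ∘ Δ` of `C_s` on `SU_q(2)`. -/
def coact : SUq q →ₗ[k] SUq q ⊗[k] C q s :=
  (π q s).lTensor (SUq q) ∘ₗ Coalgebra.comul

/-- The entries of the column `(α + sβ, γ + sδ)`. -/
def col₁ : SUq q := α q + s • β q
def col₂ : SUq q := γ q + s • δ q
/-- The entries of the row `(δ - qsγ, sα - q⁻¹β)`. -/
def row₁ : SUq q := δ q - ((q : k) * s) • γ q
def row₂ : SUq q := s • α q - (q : k)⁻¹ • β q

lemma col₁_row₁ : col₁ q s * row₁ q s = 1 - ζ q s := by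
  have hq : (q : k) ≠ 0 := q.ne_zero
  simp only [col₁, row₁, ζ, pow_two, add_mul, mul_sub, mul_smul_comm, smul_mul_assoc, smul_sub,
    βα, γα, γβ, δβ, δγ, αδ, δα]
  match_scalars <;> field_simp <;> ring

lemma col₁_row₂ : col₁ q s * row₂ q s = ξ q s := by
  have hq : (q : k) ≠ 0 := q.ne_zero
  simp only [col₁, row₂, ξ, pow_two, add_mul, mul_sub, mul_smul_comm, smul_mul_assoc, smul_sub,
    βα, γα, γβ, δβ, δγ, αδ, δα]
  match_scalars <;> field_simp <;> ring

lemma col₂_row₁ : col₂ q s * row₁ q s = - η q s := by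
  have hq : (q : k) ≠ 0 := q.ne_zero
  simp only [col₂, row₁, η, pow_two, add_mul, mul_sub, mul_smul_comm, smul_mul_assoc, smul_sub,
    βα, γα, γβ, δβ, δγ, αδ, δα]
  match_scalars <;> field_simp <;> ring

lemma col₂_row₂ : col₂ q s * row₂ q s = algebraMap k _ (s ^ 2) + ((q : k)⁻¹ ^ 2) • ζ q s := by
  have hq : (q : k) ≠ 0 := q.ne_zero
  simp only [col₂, row₂, ζ, pow_two, add_mul, mul_sub, mul_smul_comm, smul_mul_assoc, smul_sub,
    βα, γα, γβ, δβ, δγ, αδ, δα, Algebra.algebraMap_eq_smul_one]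
  match_scalars <;> field_simp <;> ring

lemma comul_col₁ : comulHom q (col₁ q s) = α q ⊗ₜ col₁ q s + β q ⊗ₜ col₂ q s := by
  simp only [col₁, col₂, map_add, map_smul, comulHom_gen, comulGen, TensorProduct.tmul_add,
    TensorProduct.tmul_smul]
  module

lemma comul_col₂ : comulHom q (col₂ q s) = γ q ⊗ₜ col₁ q s + δ q ⊗ₜ col₂ q s := by
  simp only [col₁, col₂, map_add, map_smul, comulHom_gen, comulGen, TensorProduct.tmul_add,
    TensorProduct.tmul_smul]
  module

lemma comul_row₁ :
    comulHom q (row₁ q s) = δ q ⊗ₜ row₁ q s - (q : k) • (γ q ⊗ₜ row₂ q s) := by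
  have hq : (q : k) ≠ 0 := q.ne_zero
  simp only [row₁, row₂, map_sub, map_smul, comulHom_gen, comulGen, TensorProduct.tmul_sub,
    TensorProduct.tmul_smul]
  match_scalars <;> field_simp

lemma comul_row₂ :
    comulHom q (row₂ q s) = α q ⊗ₜ row₂ q s - (q : k)⁻¹ • (β q ⊗ₜ row₁ q s) := by
  have hq : (q : k) ≠ 0 := q.ne_zero
  simp only [row₁, row₂, map_sub, map_smul, comulHom_gen, comulGen, TensorProduct.tmul_sub,
    TensorProduct.tmul_smul]
  match_scalars <;> field_simp

lemma π_ξ_mul (p : SUq q) : π q s (ξ q s * p) = s • π q s p := by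
  have : π q s ((ξ q s - algebraMap k _ s) * p) = 0 :=
    (Submodule.Quotient.mk_eq_zero _).2 (Submodule.subset_span ⟨_, by simp, p, rfl⟩)
  rwa [sub_mul, map_sub, ← Algebra.smul_def, map_smul, sub_eq_zero] at this

lemma π_η_mul (p : SUq q) : π q s (η q s * p) = -(s • π q s p) := by
  have : π q s ((η q s + algebraMap k _ s) * p) = 0 :=
    (Submodule.Quotient.mk_eq_zero _).2 (Submodule.subset_span ⟨_, by simp, p, rfl⟩)
  rwa [add_mul, map_add, ← Algebra.smul_def, map_smul, add_eq_zero_iff_eq_neg] at this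

lemma π_ζ_mul (p : SUq q) : π q s (ζ q s * p) = 0 :=
  (Submodule.Quotient.mk_eq_zero _).2 (Submodule.subset_span ⟨_, by simp, p, rfl⟩)

/-- If `Δ(b) = ∑ bᵢ ⊗ bᵢ'` and each `bᵢ'` acts on `C_s` from the left through a scalar, then the
coaction commutes with left multiplication by `b`; here for `b` a product of a column entry and
a row entry. -/
lemma coact_mul_aux {c r a a' d d' : SUq q} (u v : k)
    (hc : comulHom q c = a ⊗ₜ col₁ q s + a' ⊗ₜ col₂ q s)
    (hr : comulHom q r = u • (d ⊗ₜ row₁ q s) - v • (d' ⊗ₜ row₂ q s))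
    (h : c * r = (a + s • a') * (u • d - (v * s) • d')) (p : SUq q) :
    coact q s (c * r * p) = (LinearMap.mulLeft k (c * r)).rTensor _ (coact q s p) := by
  simp only [coact, LinearMap.comp_apply, comul_eq, map_mul (comulHom q), hc, hr]
  rw [h]
  induction comulHom q p with
  | zero => simp
  | add x y hx hy => simp only [mul_add, map_add, hx, hy]
  | tmul x y =>
    simp only [add_mul, mul_sub, sub_mul, mul_smul_comm, smul_mul_assoc,
      Algebra.TensorProduct.tmul_mul_tmul, col₁_row₁, col₁_row₂, col₂_row₁, col₂_row₂, map_add,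
      map_sub, map_smul, LinearMap.lTensor_tmul, LinearMap.rTensor_tmul, π_ξ_mul, π_ζ_mul, π_η_mul,
      one_mul, neg_mul, map_neg, smul_zero, sub_zero, add_zero, LinearMap.mulLeft_apply,
      TensorProduct.tmul_neg, TensorProduct.tmul_smul, TensorProduct.add_tmul, zero_add,
      TensorProduct.sub_tmul, ← TensorProduct.smul_tmul', ← Algebra.smul_def]
    module

/-- The coaction is left `S²_{qs}`-linear. -/
lemma coact_mul {b : SUq q} (hb : b ∈ sphere q s) (p : SUq q) :
    coact q s (b * p) = (LinearMap.mulLeft k b).rTensor _ (coact q s p) := by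
  have h11 := coact_mul_aux q s 1 (q : k) (comul_col₁ q s)
    (by rw [comul_row₁, one_smul]) (by rw [col₁, row₁, one_smul])
  have h12 := coact_mul_aux q s (-(q : k)⁻¹) (-1) (comul_col₁ q s) (r := row₂ q s)
    (by rw [comul_row₂]; module) (by rw [col₁, row₂]; congr 1; module)
  have h21 := coact_mul_aux q s 1 (q : k) (comul_col₂ q s)
    (by rw [comul_row₁, one_smul]) (by rw [col₂, row₁, one_smul])
  have hadd : ∀ b c : SUq q, LinearMap.mulLeft k (b + c)
      = LinearMap.mulLeft k b + LinearMap.mulLeft k c := fun b c => by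
    ext x; simp [add_mul]
  have hsub : ∀ b c : SUq q, LinearMap.mulLeft k (b - c)
      = LinearMap.mulLeft k b - LinearMap.mulLeft k c := fun b c => by
    ext x; simp [sub_mul]
  have hneg : ∀ b : SUq q, LinearMap.mulLeft k (-b) = - LinearMap.mulLeft k b := fun b => by
    ext x; simp
  have hone : LinearMap.mulLeft k (1 : SUq q) = LinearMap.id := by ext x; simp
  induction hb using Algebra.adjoin_induction generalizing p with
  | mem x hx =>
    rcases hx with rfl | rfl | rfl
    · rw [← col₁_row₂, h12]
    · rw [show η q s = -(col₂ q s * row₁ q s) by rw [col₂_row₁, neg_neg], neg_mul, map_neg, h21,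
        hneg, LinearMap.rTensor_neg, LinearMap.neg_apply]
    · rw [show ζ q s = 1 - col₁ q s * row₁ q s by rw [col₁_row₁]; abel, sub_mul, map_sub, h11,
        one_mul, hsub, LinearMap.rTensor_sub, LinearMap.sub_apply, hone]
      simp
  | algebraMap c =>
    have : LinearMap.mulLeft k (algebraMap k (SUq q) c) = c • LinearMap.id := by
      ext x; simp [Algebra.smul_def]
    rw [this, ← Algebra.smul_def, map_smul, LinearMap.rTensor_smul]
    simp
  | add x y _ _ hx hy => rw [add_mul, map_add, hx, hy, hadd, LinearMap.rTensor_add]; rfl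
  | mul x y _ _ hx hy =>
    rw [mul_assoc, hx, hy, LinearMap.mulLeft_mul, LinearMap.rTensor_comp]; rfl

lemma coact_smul (b : sphere q s) (p : SUq q) : coact q s (b • p) = b • coact q s p := by
  rw [Subalgebra.smul_def, smul_eq_mul, coact_mul q s b.2]
  induction coact q s p with
  | zero => simp
  | add x y hx hy => simp only [map_add, smul_add, hx, hy]
  | tmul x y => rfl

/-- `(π_s ⊗ π_s) ∘ Δ` descends to `C_s`. -/
lemma comul_J : J q s ≤ LinearMap.ker (((π q s).rTensor _) ∘ₗ coact q s) := by
  refine Submodule.span_le.2 ?_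
  have key : ∀ b : SUq q, b ∈ sphere q s → (∀ x, π q s (b * x) = 0) → ∀ p,
      (π q s).rTensor (C q s) (coact q s (b * p)) = 0 := by
    intro b hb h p
    rw [coact_mul q s hb, ← LinearMap.rTensor_comp_apply,
      show π q s ∘ₗ LinearMap.mulLeft k b = 0 from LinearMap.ext h, LinearMap.rTensor_zero]
    rfl
  rintro _ ⟨b, hb, p, rfl⟩
  refine key b ?_ ?_ p
  · rcases hb with rfl | rfl | rfl
    · exact sub_mem (sξ q s).2 (algebraMap_mem _ _)
    · exact add_mem (sη q s).2 (algebraMap_mem _ _)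
    · exact (sζ q s).2
  · exact fun x => (Submodule.Quotient.mk_eq_zero _).2 (Submodule.subset_span ⟨b, hb, x, rfl⟩)

lemma counit_J : J q s ≤ LinearMap.ker (Coalgebra.counit (R := k) (A := SUq q)) := by
  refine Submodule.span_le.2 ?_
  rintro _ ⟨b, hb, p, rfl⟩
  rcases hb with rfl | rfl | rfl <;>
  simp [counit_eq, ξ, η, ζ, counitHom_gen, counitGen]

/-- The coproduct of `C_s`, induced from that of `SU_q(2)`. -/
def comulC : C q s →ₗ[k] C q s ⊗[k] C q s :=
  (J q s).liftQ ((π q s).rTensor _ ∘ₗ coact q s) (comul_J q s)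

/-- The counit of `C_s`, induced from that of `SU_q(2)`. -/
def counitC : C q s →ₗ[k] k := (J q s).liftQ Coalgebra.counit (counit_J q s)

lemma comulC_π (x : SUq q) :
    comulC q s (π q s x) = TensorProduct.map (π q s) (π q s) (Coalgebra.comul (R := k) x) := by
  change (π q s).rTensor _ ((π q s).lTensor _ _) = _
  rw [← LinearMap.comp_apply, LinearMap.rTensor_comp_lTensor]

lemma counitC_π (x : SUq q) : counitC q s (π q s x) = Coalgebra.counit (R := k) x := rfl

/-- The coalgebra `C_s`. -/
instance : Coalgebra k (C q s) where
  comul := comulC q s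
  counit := counitC q s
  coassoc := by
    refine Submodule.linearMap_qext _ (LinearMap.ext fun p => ?_)
    have h1 : ∀ t : SUq q ⊗[k] SUq q, TensorProduct.assoc k _ _ _
        ((comulC q s).rTensor _ (TensorProduct.map (π q s) (π q s) t))
        = TensorProduct.map (π q s) (TensorProduct.map (π q s) (π q s))
          (TensorProduct.assoc k _ _ _ (Coalgebra.comul.rTensor _ t)) := by
      intro t
      induction t with
      | zero => simp
      | add x y hx hy => simp only [map_add, hx, hy]
      | tmul x y =>
        rw [TensorProduct.map_tmul, LinearMap.rTensor_tmul, LinearMap.rTensor_tmul, comulC_π]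
        induction Coalgebra.comul (R := k) x with
        | zero => simp
        | add x y hx hy => simp only [map_add, TensorProduct.add_tmul, hx, hy]
        | tmul a b => rfl
    have h2 : ∀ t : SUq q ⊗[k] SUq q,
        (comulC q s).lTensor _ (TensorProduct.map (π q s) (π q s) t)
        = TensorProduct.map (π q s) (TensorProduct.map (π q s) (π q s))
          (Coalgebra.comul.lTensor _ t) := by
      intro t
      induction t with
      | zero => simp
      | add x y hx hy => simp only [map_add, hx, hy]
      | tmul x y =>
        rw [TensorProduct.map_tmul, LinearMap.lTensor_tmul, LinearMap.lTensor_tmul, comulC_π]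
        rfl
    change TensorProduct.assoc k _ _ _ ((comulC q s).rTensor _ (comulC q s (π q s p)))
      = (comulC q s).lTensor _ (comulC q s (π q s p))
    rw [comulC_π, h1, h2, Coalgebra.coassoc_apply]
  rTensor_counit_comp_comul := by
    refine Submodule.linearMap_qext _ (LinearMap.ext fun p => ?_)
    change (counitC q s).rTensor _ (comulC q s (π q s p)) = 1 ⊗ₜ π q s p
    have h : ∀ t : SUq q ⊗[k] SUq q,
        (counitC q s).rTensor _ (TensorProduct.map (π q s) (π q s) t)
        = (π q s).lTensor k (Coalgebra.counit.rTensor _ t) := by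
      intro t
      induction t with
      | zero => simp
      | add x y hx hy => simp only [map_add, hx, hy]
      | tmul x y => rfl
    rw [comulC_π, h, Coalgebra.rTensor_counit_comul]
    rfl
  lTensor_counit_comp_comul := by
    refine Submodule.linearMap_qext _ (LinearMap.ext fun p => ?_)
    change (counitC q s).lTensor _ (comulC q s (π q s p)) = π q s p ⊗ₜ 1
    have h : ∀ t : SUq q ⊗[k] SUq q,
        (counitC q s).lTensor _ (TensorProduct.map (π q s) (π q s) t)
        = (π q s).rTensor k (Coalgebra.counit.lTensor _ t) := by
      intro t
      induction t with
      | zero => simp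
      | add x y hx hy => simp only [map_add, hx, hy]
      | tmul x y => rfl
    rw [comulC_π, h, Coalgebra.lTensor_counit_comul]
    rfl

/-- The left coaction `1 ↦ g₁⁺ ⊗ 1` of `C_s` on `V = k`, where `g₁⁺ = π_s(α + sβ)`. -/
def leftCoact : k →ₗ[k] C q s ⊗[k] k :=
  TensorProduct.mk k (C q s) k (π q s (α q + s • β q))

/-- The left `S²_{qs}`-module associated to `SU_q(2)` and a left coaction `V → C_s ⊗ V`. -/
def associatedModule {V : Type*} [AddCommGroup V] [Module k V] (ΔV : V →ₗ[k] C q s ⊗[k] V) :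
    Submodule (sphere q s) (SUq q ⊗[k] V) where
  carrier := {x | TensorProduct.assoc k (SUq q) (C q s) V ((coact q s).rTensor V x)
    = ΔV.lTensor (SUq q) x}
  add_mem' {x y} hx hy := by
    simp only [Set.mem_ofPred_eq, map_add] at hx hy ⊢
    rw [hx, hy]
  zero_mem' := by simp
  smul_mem' b x hx := by
    have h1 : ∀ x : SUq q ⊗[k] V,
        TensorProduct.assoc k (SUq q) (C q s) V ((coact q s).rTensor V (b • x))
        = b • TensorProduct.assoc k (SUq q) (C q s) V ((coact q s).rTensor V x) := by
      intro x
      induction x with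
      | zero => simp
      | add x y hx hy => simp only [smul_add, map_add, hx, hy]
      | tmul p v =>
        rw [show b • p ⊗ₜ[k] v = (b • p) ⊗ₜ[k] v from rfl, LinearMap.rTensor_tmul,
          LinearMap.rTensor_tmul, coact_smul]
        induction coact q s p with
        | zero => simp
        | add x y hx hy => simp only [smul_add, map_add, TensorProduct.add_tmul, hx, hy]
        | tmul y c => rfl
    have h2 : ∀ x : SUq q ⊗[k] V, ΔV.lTensor (SUq q) (b • x) = b • ΔV.lTensor (SUq q) x := by
      intro x
      induction x with
      | zero => simp
      | add x y hx hy => simp only [smul_add, map_add, hx, hy]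
      | tmul p v => rfl
    simp only [Set.mem_ofPred_eq] at hx ⊢
    rw [h1, h2, hx]

/-- The line bundle `E_s = {x(α + sβ) + y(γ + sδ) | x, y ∈ S²_{qs}}`. -/
def lineBundle : Submodule (sphere q s) (SUq q) :=
  Submodule.span (sphere q s) {α q + s • β q, γ q + s • δ q}

/-- The matrix `e_s` with entries in the sphere. -/
def projector : Matrix (Fin 2) (Fin 2) (sphere q s) :=
  (1 + s ^ 2)⁻¹ •
    !![1 - sζ q s, sξ q s; - sη q s, algebraMap k _ (s ^ 2) + ((q : k)⁻¹ ^ 2) • sζ q s]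

/-- The left module `Bⁿ e` of row vectors `{v e | v ∈ Bⁿ}`. -/
def rowModule {B : Type*} [Ring B] {n : ℕ} (e : Matrix (Fin n) (Fin n) B) :
    Submodule B (Fin n → B) := LinearMap.range e.vecMulLinear

/-- The linear functional `τ¹` on `S²_{qs}` is a cyclic `0`-cocycle (a trace); it is pinned down by
its values on the spanning set `ζⁿ`, `ζⁿξᵐ`, `ζⁿηᵐ`. It is the regularised trace of the difference
of the two representations in which `ζ` is diagonal with eigenvalues `-s²q^{2j+2}` and `q^{2j+2}`,
`j ≥ 0`. -/
structure IsChernCocycle (τ : sphere q s →ₗ[k] k) : Prop where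
  cyclic : ∀ x y, τ (x * y) = τ (y * x)
  one : τ 1 = 0
  zeta : ∀ n : ℕ, 0 < n → τ (sζ q s ^ n) = (1 - (-s ^ 2) ^ n) / (1 - ((q : k)⁻¹ ^ 2) ^ n)
  zeta_xi : ∀ n m : ℕ, 0 < m → τ (sζ q s ^ n * sξ q s ^ m) = 0
  zeta_eta : ∀ n m : ℕ, 0 < m → τ (sζ q s ^ n * sη q s ^ m) = 0

/-- The coalgebra bundle `SU_q(2)(S²_{qs})^{C_s}` is cleft (trivial): `SU_q(2) ≅ S²_{qs} ⊗ C_s` as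
left `S²_{qs}`-modules and right `C_s`-comodules. -/
def IsCleft : Prop :=
  ∃ θ : SUq q ≃ₗ[sphere q s] sphere q s ⊗[k] C q s, ∀ p : SUq q,
    TensorProduct.assoc k (sphere q s) (C q s) (C q s)
        ((θ.toLinearMap.restrictScalars k).rTensor (C q s) (coact q s p))
      = (Coalgebra.comul (R := k) (A := C q s)).lTensor (sphere q s) (θ p)

end
end QSphere

end

/-! Everything rests on a rank-one factorisation. With the column `(α + sβ, γ + sδ)` and the row `(δ
- qsγ, sα - q⁻¹β)`, column times row is `(1 + s²) e_s` and row times column is the scalar `1 + s²`.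
Hence `e_s` is idempotent, `v ↦ v · column` identifies `B² e_s` with `E_s`, and the four entries of
`((1 + s²) e_s)² = (1 + s²)² e_s` are the relations of the sphere: `ξ` and `η` shift polynomials in
`ζ` by `ζ ↦ q^{±2} ζ`, while `ξη` and `ηξ` are polynomials in `ζ`.

So `SU_q(2)` over `k[β, γ]` and `B` over `k[ζ]` are both generalised Weyl algebras. Their normal
forms are unique because the summands are torus eigenvectors with distinct eigenvalues. For
`SU_q(2)` this gives the absence of zero divisors; for `B` it allows `τ¹` to be defined on the
degree-zero part, a polynomial in `ζ`. The trace property comes down to `chernPoly_scaleX`: the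
values of `τ¹` invert `1 - σ⁻¹` up to the evaluations at `1` and `-s²`, which are the roots of `ξη`.

A trace functional takes equal values on idempotents with isomorphic row modules
(`trace_eq_of_equiv`). As `τ¹(tr e_s) = -1` and `τ¹(1) = 0`, `E_s` is not free of rank one.
Triviality of `E'_s` and cleftness each produce a charge-one element `p` such that every charge-one
element lies in `Bp`. Then `p · rowᵢ · p` has charge one, and cancelling `p` shows `p · rowᵢ ∈ B`,
so `E_s = Bp` would be free (`nonempty_lineBundle_equiv`). This avoids computing the coinvariants of
`SU_q(2)` or showing that `E'_s` equals `E_s`. -/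

noncomputable section

/-! ### Generalised Weyl algebras and their normal forms -/

/-- A generalised Weyl algebra datum in `A`: a commutative algebra `R` acting through `ι`, and
elements `X`, `Y` which shift `R` by the automorphism `σ`, with `Y X = a` and `X Y = σ a`. -/
structure GenWeyl (k R A : Type*) [Field k] [CommRing R] [Algebra k R] [Ring A] [Algebra k A] where
  ι : R →ₐ[k] A
  σ : R ≃ₐ[k] R
  X : A
  Y : A
  a : R
  X_ι : ∀ r, X * ι r = ι (σ r) * X
  Y_ι : ∀ r, Y * ι r = ι (σ⁻¹ r) * Y
  YX : Y * X = ι a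
  XY : X * Y = ι (σ a)

namespace GenWeyl
variable {k R A : Type*} [Field k] [CommRing R] [Algebra k R] [Ring A] [Algebra k A]
  (G : GenWeyl k R A)

/-- The element `X ^ n` for `n ≥ 0` and `Y ^ (-n)` for `n < 0`. -/
def mon : ℤ → A
  | .ofNat n => G.X ^ n
  | .negSucc n => G.Y ^ (n + 1)

lemma mon_natCast (n : ℕ) : G.mon n = G.X ^ n := rfl

lemma mon_zero : G.mon 0 = 1 := pow_zero _

lemma mon_one : G.mon 1 = G.X := pow_one _

lemma mon_neg_one : G.mon (-1) = G.Y := pow_one _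

lemma mon_neg_natCast (n : ℕ) : G.mon (-(n : ℤ)) = G.Y ^ n := by
  cases n with
  | zero => simp [mon_zero]
  | succ n => rfl

lemma mon_ι (n : ℤ) (r : R) : G.mon n * G.ι r = G.ι ((G.σ ^ n) r) * G.mon n := by
  have hX : ∀ (n : ℕ) (r : R), G.X ^ n * G.ι r = G.ι ((G.σ ^ n) r) * G.X ^ n := by
    intro n
    induction n with
    | zero => simp
    | succ n ih =>
      intro r
      rw [pow_succ, mul_assoc, G.X_ι, ← mul_assoc, ih, mul_assoc, pow_succ]
      rfl
  have hY : ∀ (n : ℕ) (r : R), G.Y ^ n * G.ι r = G.ι ((G.σ⁻¹ ^ n) r) * G.Y ^ n := by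
    intro n
    induction n with
    | zero => simp
    | succ n ih =>
      intro r
      rw [pow_succ, mul_assoc, G.Y_ι, ← mul_assoc, ih, mul_assoc, pow_succ]
      rfl
  obtain ⟨n, rfl | rfl⟩ := n.eq_nat_or_neg
  · rw [mon_natCast, hX, zpow_natCast]
  · rw [mon_neg_natCast, hY, zpow_neg, zpow_natCast, inv_pow]

lemma X_mon (n : ℤ) :
    ∃ c : R, (G.a ≠ 0 → c ≠ 0) ∧ G.X * G.mon n = G.ι c * G.mon (n + 1) := by
  cases n with
  | ofNat n =>
    -- Nontriviality of `R`, needed for `1 ≠ 0`, comes from `a ≠ 0`.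
    refine ⟨1, fun h h' => h (by rw [← mul_one G.a, h', mul_zero]), ?_⟩
    change G.X * G.X ^ n = _ * G.X ^ (n + 1)
    rw [map_one, one_mul, pow_succ']
  | negSucc n =>
    refine ⟨G.σ G.a, by simp, ?_⟩
    have : Int.negSucc n + 1 = -(n : ℤ) := by omega
    rw [this, mon_neg_natCast]
    change G.X * G.Y ^ (n + 1) = _
    rw [pow_succ', ← mul_assoc, G.XY]

lemma Y_mon (n : ℤ) :
    ∃ c : R, (G.a ≠ 0 → c ≠ 0) ∧ G.Y * G.mon n = G.ι c * G.mon (n - 1) := by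
  obtain ⟨n, rfl | rfl⟩ : ∃ m : ℕ, n = (m : ℤ) + 1 ∨ n = -m := by
    rcases le_or_gt n 0 with h | h
    · exact ⟨n.natAbs, by omega⟩
    · exact ⟨n.natAbs - 1, by omega⟩
  · refine ⟨G.a, id, ?_⟩
    rw [add_sub_cancel_right, mon_natCast]
    change G.Y * G.X ^ (n + 1) = _
    rw [pow_succ', ← mul_assoc, G.YX]
  · refine ⟨1, fun h h' => h (by rw [← mul_one G.a, h', mul_zero]), ?_⟩
    have : (-n - 1 : ℤ) = -((n + 1 : ℕ) : ℤ) := by push_cast; ring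
    rw [this, mon_neg_natCast, mon_neg_natCast, map_one, one_mul, pow_succ']

/-- Every cancellation of an `X` against a `Y` contributes a shift of `a`, so the constant is a
product of such shifts. `IsDomain` is asked for only inside the conclusion, so that `coc` exists
over any `R`. -/
lemma mon_mul_mon (m n : ℤ) : ∃ c : R, (G.a ≠ 0 → ∀ [IsDomain R], c ≠ 0) ∧
    G.mon m * G.mon n = G.ι c * G.mon (m + n) := by
  have hX : ∀ m : ℕ, ∃ c : R, (G.a ≠ 0 → ∀ [IsDomain R], c ≠ 0) ∧
      G.X ^ m * G.mon n = G.ι c * G.mon (m + n) := by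
    intro m
    induction m with
    | zero => exact ⟨1, fun _ _ => one_ne_zero, by simp⟩
    | succ m ih =>
      obtain ⟨c, hc, e⟩ := ih
      obtain ⟨d, hd, e'⟩ := G.X_mon (m + n)
      refine ⟨G.σ c * d, fun h _ => mul_ne_zero (by simpa using hc h) (hd h), ?_⟩
      rw [pow_succ', mul_assoc, e, ← mul_assoc, G.X_ι, mul_assoc, e', map_mul, mul_assoc]
      congr 3
      push_cast; ring
  have hY : ∀ m : ℕ, ∃ c : R, (G.a ≠ 0 → ∀ [IsDomain R], c ≠ 0) ∧
      G.Y ^ m * G.mon n = G.ι c * G.mon (-m + n) := by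
    intro m
    induction m with
    | zero => exact ⟨1, fun _ _ => one_ne_zero, by simp⟩
    | succ m ih =>
      obtain ⟨c, hc, e⟩ := ih
      obtain ⟨d, hd, e'⟩ := G.Y_mon (-m + n)
      refine ⟨G.σ⁻¹ c * d, fun h _ => mul_ne_zero (by simpa using hc h) (hd h), ?_⟩
      rw [pow_succ', mul_assoc, e, ← mul_assoc, G.Y_ι, mul_assoc, e', map_mul, mul_assoc]
      congr 3
      push_cast; ring
  obtain ⟨m, rfl | rfl⟩ := m.eq_nat_or_neg
  · exact hX m
  · rw [mon_neg_natCast]; exact hY m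

/-- The normal form map `f ↦ ∑ ι (f n) * mon n`. -/
def normalForm : (ℤ →₀ R) →ₗ[k] A :=
  Finsupp.lsum k fun n => LinearMap.mulRight k (G.mon n) ∘ₗ G.ι.toLinearMap

lemma normalForm_single (n : ℤ) (r : R) :
    G.normalForm (Finsupp.single n r) = G.ι r * G.mon n := by
  simp [normalForm]

lemma normalForm_apply (f : ℤ →₀ R) :
    G.normalForm f = f.sum fun n r => G.ι r * G.mon n := by
  simp [normalForm, Finsupp.lsum_apply]
  rfl

/-- The structure constants of the normal form. -/
def coc (m n : ℤ) : R := (G.mon_mul_mon m n).choose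

lemma coc_ne_zero [IsDomain R] (h : G.a ≠ 0) (m n : ℤ) : G.coc m n ≠ 0 :=
  (G.mon_mul_mon m n).choose_spec.1 h

lemma single_mul_single (m n : ℤ) (r r' : R) :
    G.ι r * G.mon m * (G.ι r' * G.mon n)
      = G.normalForm (Finsupp.single (m + n) (r * (G.σ ^ m) r' * G.coc m n)) := by
  rw [normalForm_single, mul_assoc, ← mul_assoc (G.mon m), G.mon_ι, mul_assoc (G.ι ((G.σ ^ m) r')),
    (G.mon_mul_mon m n).choose_spec.2]
  simp only [map_mul, mul_assoc]
  rfl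

lemma normalForm_mul (f g : ℤ →₀ R) : G.normalForm f * G.normalForm g
    = G.normalForm (f.sum fun m r => g.sum fun n r' =>
        Finsupp.single (m + n) (r * (G.σ ^ m) r' * G.coc m n)) := by
  simp only [G.normalForm_apply f, G.normalForm_apply g, Finsupp.sum, map_sum, Finset.sum_mul_sum,
    single_mul_single]

/-- The subalgebra of all elements that have a normal form. -/
def subalgebra : Subalgebra k A where
  carrier := LinearMap.range G.normalForm
  mul_mem' := by
    rintro _ _ ⟨f, rfl⟩ ⟨g, rfl⟩
    exact ⟨_, (G.normalForm_mul f g).symm⟩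
  add_mem' := add_mem
  algebraMap_mem' r :=
    ⟨Finsupp.single 0 (algebraMap k R r), by rw [normalForm_single, mon_zero]; simp⟩

lemma mem_subalgebra {x : A} : x ∈ G.subalgebra ↔ ∃ f, G.normalForm f = x := Iff.rfl

lemma ι_mem (r : R) : G.ι r ∈ G.subalgebra :=
  ⟨Finsupp.single 0 r, by rw [normalForm_single, mon_zero, mul_one]⟩

lemma X_mem : G.X ∈ G.subalgebra :=
  ⟨Finsupp.single 1 1, by rw [normalForm_single, mon_one, map_one, one_mul]⟩

lemma Y_mem : G.Y ∈ G.subalgebra :=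
  ⟨Finsupp.single (-1) 1, by rw [normalForm_single, mon_neg_one, map_one, one_mul]⟩

/-- Normal forms are unique when the summands are eigenvectors of an algebra map, with distinct
eigenvalues. -/
lemma normalForm_injective (D : A →ₐ[k] A) (l : kˣ) (hl : ∀ n : ℕ, 0 < n → (l : k) ^ n ≠ 1)
    (hι : ∀ r, D (G.ι r) = G.ι r) (hX : D G.X = (l : k) • G.X) (hY : D G.Y = (l : k)⁻¹ • G.Y)
    (h0 : ∀ n r, G.ι r * G.mon n = 0 → r = 0) : Function.Injective G.normalForm := by
  have hD : ∀ (n : ℤ) (r : R), D (G.ι r * G.mon n) = ((l : k) ^ n) • (G.ι r * G.mon n) := by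
    intro n r
    obtain ⟨n, rfl | rfl⟩ := n.eq_nat_or_neg
    · rw [mon_natCast, map_mul, map_pow, hι, hX, smul_pow, mul_smul_comm, zpow_natCast]
    · rw [mon_neg_natCast, map_mul, map_pow, hι, hY, smul_pow, mul_smul_comm, zpow_neg,
        zpow_natCast, inv_pow]
  have hl' : Function.Injective fun n : ℤ => (l : k) ^ n := by
    have aux : ∀ m n : ℤ, m < n → (l : k) ^ m ≠ (l : k) ^ n := by
      intro m n hmn h
      refine hl (n - m).toNat (by omega) ?_
      rw [← zpow_natCast, Int.toNat_of_nonneg (by omega), zpow_sub₀ l.ne_zero, h,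
        div_self (zpow_ne_zero _ l.ne_zero)]
    intro m n h
    rcases lt_trichotomy m n with h' | h' | h'
    · exact (aux _ _ h' h).elim
    · exact h'
    · exact (aux _ _ h' h.symm).elim
  rw [injective_iff_map_eq_zero]
  intro f hf
  have hind := Module.End.eigenvectors_linearIndependent' D.toLinearMap
    (fun n : f.support => (l : k) ^ (n : ℤ)) (hl'.comp Subtype.val_injective)
    (fun n => G.ι (f n) * G.mon n) (fun n => ⟨Module.End.mem_eigenspace_iff.2 (hD _ _),
      fun h => (Finsupp.mem_support_iff.1 n.2) (h0 _ _ h)⟩)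
  rw [Fintype.linearIndependent_iff] at hind
  -- The vanishing of the normal form is a linear relation among eigenvectors with all coefficients
  -- equal to `1`.
  have hs : ∑ n : f.support, (1 : k) • (G.ι (f n) * G.mon n) = 0 := by
    simp only [one_smul]
    rw [Finset.sum_coe_sort f.support fun n => G.ι (f n) * G.mon n, ← hf, normalForm_apply]
    rfl
  ext n
  by_contra hn
  exact one_ne_zero (hind (fun _ => 1) hs ⟨n, Finsupp.mem_support_iff.2 hn⟩)

/-- Since `ℤ` has unique sums, some degree `m + n` of the product arises from exactly one pair of
degrees of the factors. Its coefficient is a single product of nonzero elements of `R`. -/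
lemma noZeroDivisors [IsDomain R] (ha : G.a ≠ 0) (hinj : Function.Injective G.normalForm)
    (htop : G.subalgebra = ⊤) : NoZeroDivisors A := by
  refine ⟨fun {x y} hxy => ?_⟩
  obtain ⟨f, rfl⟩ := G.mem_subalgebra.1 (htop ▸ Algebra.mem_top : x ∈ G.subalgebra)
  obtain ⟨g, rfl⟩ := G.mem_subalgebra.1 (htop ▸ Algebra.mem_top : y ∈ G.subalgebra)
  by_contra! hne
  have hf : f.support.Nonempty := Finsupp.support_nonempty_iff.2 fun h => hne.1 (by simp [h])
  have hg : g.support.Nonempty := Finsupp.support_nonempty_iff.2 fun h => hne.2 (by simp [h])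
  obtain ⟨m, hm, n, hn, hu⟩ := UniqueSums.uniqueAdd_of_nonempty hf hg
  rw [normalForm_mul, map_eq_zero_iff _ hinj] at hxy
  have hc := DFunLike.congr_fun hxy (m + n)
  simp only [Finsupp.sum, Finsupp.finsetSum_apply, Finsupp.coe_zero, Pi.zero_apply] at hc
  rw [Finset.sum_eq_single_of_mem m hm, Finset.sum_eq_single_of_mem n hn,
    Finsupp.single_eq_same] at hc
  · refine mul_ne_zero (mul_ne_zero (Finsupp.mem_support_iff.1 hm) ?_) (G.coc_ne_zero ha m n) hc
    simpa using Finsupp.mem_support_iff.1 hn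
  · intro j hj hjn
    exact Finsupp.single_eq_of_ne fun h => hjn (hu hm hj h.symm).2
  · intro i hi him
    refine Finset.sum_eq_zero fun j hj => ?_
    exact Finsupp.single_eq_of_ne fun h => him (hu hi hj h.symm).1

end GenWeyl
end

/-! ### `SU_q(2)` as a generalised Weyl algebra over `k[β, γ]` -/

noncomputable section
namespace QSphere
namespace SUq
variable {k : Type*} [Field k] (q : kˣ)

open MvPolynomial in
/-- The automorphism of `k[b, c]` which scales both variables by `q`. -/
def scaleBC : MvPolynomial (Fin 2) k ≃ₐ[k] MvPolynomial (Fin 2) k :=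
  AlgEquiv.ofAlgHom (aeval fun i => (q : k) • X i) (aeval fun i => (q : k)⁻¹ • X i)
    (by ext i; simp [smul_smul]) (by ext i; simp [smul_smul])

lemma scaleBC_X (i : Fin 2) : scaleBC q (MvPolynomial.X i) = (q : k) • MvPolynomial.X i := by
  simp [scaleBC]

lemma scaleBC_symm_X (i : Fin 2) :
    (scaleBC q).symm (MvPolynomial.X i) = (q : k)⁻¹ • MvPolynomial.X i := by
  simp [scaleBC]

lemma beta_gamma_comm : ∀ a ∈ ({β q, γ q} : Set (SUq q)), ∀ b ∈ ({β q, γ q} : Set (SUq q)),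
    a * b = b * a := by
  rintro _ (rfl | rfl) _ (rfl | rfl) <;> simp [rel_βγ]

open scoped IsMulCommutative in
/-- The algebra map `k[b, c] → SU_q(2)` with `b ↦ β` and `c ↦ γ`. -/
def polyBC : MvPolynomial (Fin 2) k →ₐ[k] SUq q :=
  haveI := Algebra.isMulCommutative_adjoin k (beta_gamma_comm q)
  (Algebra.adjoin k ({β q, γ q} : Set (SUq q))).val.comp
    (MvPolynomial.aeval (![⟨β q, Algebra.subset_adjoin (by simp)⟩,
      ⟨γ q, Algebra.subset_adjoin (by simp)⟩] :
        Fin 2 → Algebra.adjoin k ({β q, γ q} : Set (SUq q))))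

lemma polyBC_X_zero : polyBC q (MvPolynomial.X 0) = β q := by
  simp [polyBC]

lemma polyBC_X_one : polyBC q (MvPolynomial.X 1) = γ q := by
  simp [polyBC]

/-- If `x β = l • β x` and `x γ = l • γ x` then `x` shifts the polynomials in `β`, `γ`. -/
lemma mul_polyBC {x : SUq q} {l : k} {f : MvPolynomial (Fin 2) k ≃ₐ[k] MvPolynomial (Fin 2) k}
    (hf : ∀ i, f (MvPolynomial.X i) = l • MvPolynomial.X i)
    (hβ : x * β q = l • (β q * x)) (hγ : x * γ q = l • (γ q * x)) (r : MvPolynomial (Fin 2) k) :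
    x * polyBC q r = polyBC q (f r) * x := by
  induction r using MvPolynomial.induction_on with
  | C c =>
    rw [← MvPolynomial.algebraMap_eq, AlgHom.commutes, AlgEquiv.commutes, AlgHom.commutes,
      Algebra.commutes]
  | add r r' h h' => simp only [map_add, mul_add, add_mul, h, h']
  | mul_X r i h =>
    rw [map_mul, ← mul_assoc, h, map_mul, map_mul, hf, mul_assoc, mul_assoc]
    congr 1
    rw [map_smul]
    fin_cases i
    · simpa [polyBC_X_zero] using hβ
    · simpa [polyBC_X_one] using hγ

lemma alpha_polyBC (r : MvPolynomial (Fin 2) k) :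
    α q * polyBC q r = polyBC q (scaleBC q r) * α q :=
  mul_polyBC q (scaleBC_X q) (rel_αβ q) (rel_αγ q) r

lemma delta_polyBC (r : MvPolynomial (Fin 2) k) :
    δ q * polyBC q r = polyBC q ((scaleBC q)⁻¹ r) * δ q :=
  mul_polyBC q (scaleBC_symm_X q) (δβ q) (δγ q) r

/-- `SU_q(2)` as a generalised Weyl algebra over `k[b, c]`. -/
def genWeyl : GenWeyl k (MvPolynomial (Fin 2) k) (SUq q) where
  ι := polyBC q
  σ := scaleBC q
  X := α q
  Y := δ q
  a := 1 + (q : k)⁻¹ • (MvPolynomial.X 0 * MvPolynomial.X 1)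
  X_ι := alpha_polyBC q
  Y_ι := delta_polyBC q
  YX := by
    simp [polyBC_X_zero, polyBC_X_one, δα]
  XY := by
    simp [polyBC_X_zero, polyBC_X_one, αδ, scaleBC_X, smul_smul]

lemma genWeyl_subalgebra : (genWeyl q).subalgebra = ⊤ := by
  have h : ∀ g, gen q g ∈ (genWeyl q).subalgebra := by
    intro g
    cases g with
    | α => exact (genWeyl q).X_mem
    | β => exact (polyBC_X_zero q).subst (motive := (· ∈ (genWeyl q).subalgebra)) ((genWeyl q).ι_mem _)
    | γ => exact (polyBC_X_one q).subst (motive := (· ∈ (genWeyl q).subalgebra)) ((genWeyl q).ι_mem _)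
    | δ => exact (genWeyl q).Y_mem
  rw [eq_top_iff]
  rintro x -
  obtain ⟨w, rfl⟩ : ∃ w, mk q w = x := RingQuot.mkAlgHom_surjective k (Rel q) x
  induction w using FreeAlgebra.induction with
  | grade0 r => rw [AlgHom.commutes]; exact algebraMap_mem _ _
  | grade1 g => exact h g
  | mul a b ha hb => rw [map_mul]; exact mul_mem ha hb
  | add a b ha hb => rw [map_add]; exact add_mem ha hb

/-- The operators on `k[b, c]` by which the generators act. -/
def repGen : Gen → Module.End k (MvPolynomial (Fin 2) k)
  | .α => (scaleBC q).toLinearMap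
  | .β => LinearMap.mulLeft k (MvPolynomial.X 0)
  | .γ => LinearMap.mulLeft k (MvPolynomial.X 1)
  -- `α` acts invertibly, so `αδ = 1 + qβγ` forces this operator.
  | .δ => (scaleBC q).symm.toLinearMap ∘ₗ
      LinearMap.mulLeft k (1 + (q : k) • (MvPolynomial.X 0 * MvPolynomial.X 1))

lemma repGen_rel ⦃x y : FreeAlgebra k Gen⦄ (h : Rel q x y) :
    FreeAlgebra.lift k (repGen q) x = FreeAlgebra.lift k (repGen q) y := by
  have hq : (q : k) ≠ 0 := q.ne_zero
  cases h <;> refine LinearMap.ext fun r => ?_ <;>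
  simp only [map_mul, map_smul, map_add, map_sub, map_one, FreeAlgebra.lift_ι_apply, repGen,
    Module.End.mul_apply, LinearMap.smul_apply, LinearMap.add_apply, LinearMap.sub_apply,
    LinearMap.comp_apply, LinearMap.mulLeft_apply, AlgEquiv.toLinearMap_apply, scaleBC_X,
    scaleBC_symm_X, AlgEquiv.apply_symm_apply, AlgEquiv.symm_apply_apply, Module.End.one_apply,
    add_mul, mul_add, one_mul, smul_mul_assoc, mul_smul_comm, smul_smul, smul_add, mul_assoc,
    mul_left_comm] <;>
  match_scalars <;> field_simp <;> ring

/-- The representation of `SU_q(2)` on `k[b, c]`. -/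
def rep : SUq q →ₐ[k] Module.End k (MvPolynomial (Fin 2) k) :=
  lift q (FreeAlgebra.lift k (repGen q)) (repGen_rel q)

lemma rep_gen (g : Gen) : rep q (gen q g) = repGen q g := by
  simp [rep, lift_gen]

lemma rep_polyBC (r p : MvPolynomial (Fin 2) k) : rep q (polyBC q r) p = r * p := by
  induction r using MvPolynomial.induction_on generalizing p with
  | C c =>
    rw [← MvPolynomial.algebraMap_eq, AlgHom.commutes, AlgHom.commutes, ← Algebra.smul_def,
      Module.algebraMap_end_apply]
  | add r r' h h' => simp only [map_add, add_mul, LinearMap.add_apply, h, h']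
  | mul_X r i h =>
    rw [map_mul, map_mul, Module.End.mul_apply, h, mul_assoc]
    fin_cases i
    · simp [polyBC_X_zero, rep_gen, repGen]
    · simp [polyBC_X_one, rep_gen, repGen]

lemma one_add_smul_ne_zero (c : k) :
    (1 + c • (MvPolynomial.X 0 * MvPolynomial.X 1) : MvPolynomial (Fin 2) k) ≠ 0 := by
  intro h
  simpa using congrArg (MvPolynomial.aeval (fun _ => (0 : k))) h

lemma rep_mon_injective (n : ℤ) : Function.Injective (rep q ((genWeyl q).mon n)) := by
  obtain ⟨n, rfl | rfl⟩ := n.eq_nat_or_neg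
  · rw [GenWeyl.mon_natCast, map_pow, Module.End.coe_pow]
    refine Function.Injective.iterate ?_ n
    change Function.Injective (rep q (gen q .α))
    rw [rep_gen]
    exact (scaleBC q).injective
  · rw [GenWeyl.mon_neg_natCast, map_pow, Module.End.coe_pow]
    refine Function.Injective.iterate ?_ n
    change Function.Injective (rep q (gen q .δ))
    rw [rep_gen]
    exact (scaleBC q).symm.injective.comp (mul_right_injective₀ (one_add_smul_ne_zero _))

/-- The values on generators of the scaling `α ↦ l α`, `δ ↦ l⁻¹ δ`, `β ↦ m β`, `γ ↦ m⁻¹ γ`. -/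
def torusGen (l m : kˣ) : Gen → SUq q
  | .α => (l : k) • α q
  | .β => (m : k) • β q
  | .γ => (m : k)⁻¹ • γ q
  | .δ => (l : k)⁻¹ • δ q

lemma torusGen_rel (l m : kˣ) ⦃x y : FreeAlgebra k Gen⦄ (h : Rel q x y) :
    FreeAlgebra.lift k (torusGen q l m) x = FreeAlgebra.lift k (torusGen q l m) y := by
  have hq : (q : k) ≠ 0 := q.ne_zero
  have hl : (l : k) ≠ 0 := l.ne_zero
  have hm : (m : k) ≠ 0 := m.ne_zero
  cases h <;>
  simp only [map_mul, map_smul, map_add, map_sub, map_one, FreeAlgebra.lift_ι_apply, torusGen,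
    smul_mul_assoc, mul_smul_comm, βα, γα, γβ, δβ, δγ, αδ, δα] <;>
  match_scalars <;> field_simp <;> ring

/-- The action of the two-dimensional torus on `SU_q(2)`. -/
def torus (l m : kˣ) : SUq q →ₐ[k] SUq q :=
  lift q (FreeAlgebra.lift k (torusGen q l m)) (torusGen_rel q l m)

lemma torus_gen (l m : kˣ) (g : Gen) : torus q l m (gen q g) = torusGen q l m g := by
  simp [torus, lift_gen]

lemma torus_polyBC (l : kˣ) (r : MvPolynomial (Fin 2) k) :
    torus q l 1 (polyBC q r) = polyBC q r := by
  induction r using MvPolynomial.induction_on with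
  | C c => rw [← MvPolynomial.algebraMap_eq, AlgHom.commutes, AlgHom.commutes]
  | add r r' h h' => simp only [map_add, h, h']
  | mul_X r i h =>
    rw [map_mul, map_mul, h]
    fin_cases i
    · simp [polyBC_X_zero, torus_gen, torusGen]
    · simp [polyBC_X_one, torus_gen, torusGen]

/-- Acting on `1 ∈ k[b, c]` turns the product into `r` times a nonzero polynomial. This is the
nonvanishing hypothesis of `normalForm_injective`. -/
lemma polyBC_mul_mon_eq_zero {n : ℤ} {r : MvPolynomial (Fin 2) k}
    (h : polyBC q r * (genWeyl q).mon n = 0) : r = 0 := by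
  have h1 : rep q (polyBC q r * (genWeyl q).mon n) 1 = 0 := by rw [h, map_zero]; rfl
  rw [map_mul, Module.End.mul_apply, rep_polyBC] at h1
  refine (mul_eq_zero.1 h1).resolve_right fun h2 =>
    one_ne_zero (α := MvPolynomial (Fin 2) k) ?_
  exact rep_mon_injective q n (h2.trans (map_zero _).symm)

variable (hq : ∀ n : ℕ, 0 < n → (q : k) ^ n ≠ 1)
include hq

/-- The torus element with `l = q`, `m = 1` fixes `β` and `γ` and scales `α` by `q`; the powers of
`q` are distinct because `q` is not a root of unity. -/
lemma noZeroDivisors : NoZeroDivisors (SUq q) := by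
  refine (genWeyl q).noZeroDivisors (one_add_smul_ne_zero _) ?_ (genWeyl_subalgebra q)
  exact (genWeyl q).normalForm_injective (torus q q 1) q hq (torus_polyBC q q)
    (torus_gen q q 1 .α) (torus_gen q q 1 .δ) fun _ _ => polyBC_mul_mon_eq_zero q

omit hq

lemma polyBC_injective : Function.Injective (polyBC q) := by
  rw [injective_iff_map_eq_zero]
  intro r h
  exact polyBC_mul_mon_eq_zero q (n := 0) (by rw [h, zero_mul])

lemma gen_ne_zero (g : Gen) : gen q g ≠ 0 := by
  intro h
  cases g with
  | α => exact one_ne_zero (polyBC_mul_mon_eq_zero q (n := 1) (r := 1)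
      (by rw [GenWeyl.mon_one, show (genWeyl q).X = 0 from h, mul_zero]))
  | β =>
    exact MvPolynomial.X_ne_zero 0 (polyBC_injective q ((polyBC_X_zero q).trans (h.trans (map_zero _).symm)))
  | γ =>
    exact MvPolynomial.X_ne_zero 1 (polyBC_injective q ((polyBC_X_one q).trans (h.trans (map_zero _).symm)))
  | δ => exact one_ne_zero (polyBC_mul_mon_eq_zero q (n := -1) (r := 1)
      (by rw [GenWeyl.mon_neg_one, show (genWeyl q).Y = 0 from h, mul_zero]))

end SUq
end QSphere
end

/-! ### The sphere as a generalised Weyl algebra over `k[ζ]` -/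

noncomputable section
namespace QSphere
open SUq
open scoped Polynomial
open Polynomial (X aeval aeval_X)

section
variable {k : Type*} [Field k]

/-- The automorphism `z ↦ l z` of `k[z]`. -/
def scaleX (l : kˣ) : k[X] ≃ₐ[k] k[X] :=
  AlgEquiv.ofAlgHom (aeval ((l : k) • X)) (aeval ((l : k)⁻¹ • X))
    (by ext; simp [smul_smul]) (by ext; simp [smul_smul])

lemma scaleX_X (l : kˣ) : scaleX l X = (l : k) • X := by simp [scaleX]

lemma scaleX_inv_X (l : kˣ) : (scaleX l)⁻¹ X = (l : k)⁻¹ • (X : k[X]) := by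
  change (scaleX l).symm X = _
  simp [scaleX]

lemma mul_aeval_of_smul {A : Type*} [Ring A] [Algebra k A] {x z : A} {l : k} {f : k[X] ≃ₐ[k] k[X]}
    (hf : f X = l • X) (h : x * z = l • (z * x)) (r : k[X]) :
    x * aeval z r = aeval z (f r) * x := by
  induction r using Polynomial.induction_on with
  | C c =>
    rw [← Polynomial.algebraMap_eq, AlgHom.commutes, AlgEquiv.commutes, AlgHom.commutes,
      Algebra.commutes]
  | add r r' h h' => simp only [map_add, mul_add, add_mul, h, h']
  | monomial n c ih =>
    rw [pow_succ, ← mul_assoc]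
    generalize Polynomial.C c * X ^ n = p at ih ⊢
    rw [map_mul, ← mul_assoc, ih, map_mul, map_mul, hf, mul_assoc, mul_assoc]
    congr 1
    simpa using h

end

section
variable {k : Type*} [Field k] (q : kˣ) (s : k)

lemma row_col : row₁ q s * col₁ q s + row₂ q s * col₂ q s = algebraMap k _ (1 + s ^ 2) := by
  have hq : (q : k) ≠ 0 := q.ne_zero
  simp only [col₁, col₂, row₁, row₂, sub_mul, mul_add, mul_smul_comm, smul_mul_assoc, smul_sub,
    βα, γα, γβ, δβ, δγ, αδ, δα, Algebra.algebraMap_eq_smul_one]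
  match_scalars <;> field_simp <;> ring

lemma row₁_col₁ : row₁ q s * col₁ q s = algebraMap k _ (1 + s ^ 2) - row₂ q s * col₂ q s :=
  eq_sub_of_add_eq (row_col q s)

lemma row₂_col₂ : row₂ q s * col₂ q s = algebraMap k _ (1 + s ^ 2) - row₁ q s * col₁ q s :=
  eq_sub_of_add_eq' (row_col q s)

/-- For `M = column · row`, `row_col` gives `M² = (1 + s²) M`. This relation and the next three are
its four entries, in the order `(1,1)`, `(2,2)`, `(1,2)`, `(2,1)`. -/
lemma ξ_mul_η : ξ q s * η q s = - ((1 - ζ q s) * (algebraMap k _ (s ^ 2) + ζ q s)) := by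
  have h : ξ q s * η q s = -(col₁ q s * (row₂ q s * col₂ q s) * row₁ q s) := by
    rw [← col₁_row₂, ← neg_neg (η q s), ← col₂_row₁]; noncomm_ring
  rw [h, row₂_col₂, show col₁ q s * (algebraMap k _ (1 + s ^ 2) - row₁ q s * col₁ q s) * row₁ q s
    = col₁ q s * algebraMap k _ (1 + s ^ 2) * row₁ q s
      - (col₁ q s * row₁ q s) * (col₁ q s * row₁ q s) by noncomm_ring,
    ← Algebra.commutes, mul_assoc, col₁_row₁, map_add, map_one]
  simp only [mul_sub, sub_mul, add_mul, mul_add, one_mul, mul_one, Algebra.commutes]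
  abel

lemma η_mul_ξ : η q s * ξ q s = - ((1 - ((q : k)⁻¹ ^ 2) • ζ q s)
    * (algebraMap k _ (s ^ 2) + ((q : k)⁻¹ ^ 2) • ζ q s)) := by
  have h : η q s * ξ q s = -(col₂ q s * (row₁ q s * col₁ q s) * row₂ q s) := by
    rw [← col₁_row₂, ← neg_neg (η q s), ← col₂_row₁]; noncomm_ring
  rw [h, row₁_col₁, show col₂ q s * (algebraMap k _ (1 + s ^ 2) - row₂ q s * col₂ q s) * row₂ q s
    = col₂ q s * algebraMap k _ (1 + s ^ 2) * row₂ q s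
      - (col₂ q s * row₂ q s) * (col₂ q s * row₂ q s) by noncomm_ring,
    ← Algebra.commutes, mul_assoc, col₂_row₂, map_add, map_one]
  simp only [mul_sub, sub_mul, add_mul, mul_add, one_mul, mul_one, Algebra.commutes]
  abel

lemma ξ_mul_ζ : ξ q s * ζ q s = ((q : k) ^ 2) • (ζ q s * ξ q s) := by
  have hq : (q : k) ≠ 0 := q.ne_zero
  have h : ξ q s * (algebraMap k _ (s ^ 2) + ((q : k)⁻¹ ^ 2) • ζ q s)
      = algebraMap k _ (1 + s ^ 2) * ξ q s - (1 - ζ q s) * ξ q s := by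
    rw [← col₂_row₂, ← col₁_row₁, ← col₁_row₂,
      show col₁ q s * row₂ q s * (col₂ q s * row₂ q s)
        = col₁ q s * (row₂ q s * col₂ q s) * row₂ q s by noncomm_ring, row₂_col₂, mul_sub,
      ← Algebra.commutes]
    noncomm_ring
  simp only [mul_add, map_add, map_one, add_mul, one_mul, sub_mul, mul_smul_comm,
    Algebra.algebraMap_eq_smul_one, smul_mul_assoc, mul_one] at h
  have h' : ((q : k)⁻¹ ^ 2) • (ξ q s * ζ q s) = ζ q s * ξ q s := by
    linear_combination (norm := module) h
  rw [← h', smul_smul, ← mul_pow, mul_inv_cancel₀ hq, one_pow, one_smul]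

lemma η_mul_ζ : η q s * ζ q s = ((q : k) ^ 2)⁻¹ • (ζ q s * η q s) := by
  have h : (algebraMap k _ (s ^ 2) + ((q : k)⁻¹ ^ 2) • ζ q s) * -η q s
      = algebraMap k _ (1 + s ^ 2) * -η q s - -η q s * (1 - ζ q s) := by
    rw [← col₂_row₂, ← col₁_row₁, ← col₂_row₁,
      show col₂ q s * row₂ q s * (col₂ q s * row₁ q s)
        = col₂ q s * (row₂ q s * col₂ q s) * row₁ q s by noncomm_ring, row₂_col₂, mul_sub,
      ← Algebra.commutes]
    noncomm_ring
  simp only [mul_add, map_add, map_one, add_mul, one_mul, mul_sub, mul_neg, neg_mul,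
    Algebra.algebraMap_eq_smul_one, smul_mul_assoc, mul_one] at h
  rw [← inv_pow]
  linear_combination (norm := module) h

lemma coe_sξ : (sξ q s : SUq q) = ξ q s := rfl
lemma coe_sη : (sη q s : SUq q) = η q s := rfl
lemma coe_sζ : (sζ q s : SUq q) = ζ q s := rfl

lemma sphere_induction {T : Subalgebra k (sphere q s)} (h1 : sξ q s ∈ T) (h2 : sη q s ∈ T)
    (h3 : sζ q s ∈ T) (x : sphere q s) : x ∈ T := by
  have h : (⊤ : Subalgebra k (sphere q s)) ≤ T := by
    refine (Algebra.adjoin_adjoin_coe_preimage (R := k)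
      (s := {ξ q s, η q s, ζ q s})).symm.le.trans (Algebra.adjoin_le ?_)
    rintro ⟨y, hy⟩ hy'
    rcases hy' with h | h | h
    · exact (Subtype.ext h : (⟨y, hy⟩ : sphere q s) = sξ q s) ▸ h1
    · exact (Subtype.ext h : (⟨y, hy⟩ : sphere q s) = sη q s) ▸ h2
    · exact (Subtype.ext h : (⟨y, hy⟩ : sphere q s) = sζ q s) ▸ h3
  exact h Algebra.mem_top

/-- The quantum sphere as a generalised Weyl algebra over `k[z]`. -/
def sphereWeyl : GenWeyl k k[X] (sphere q s) where
  ι := aeval (sζ q s)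
  σ := scaleX (k := k) (q ^ 2)
  X := sξ q s
  Y := sη q s
  a := -((1 - ((q : k)⁻¹ ^ 2) • X) * (algebraMap k _ (s ^ 2) + ((q : k)⁻¹ ^ 2) • X))
  X_ι := mul_aeval_of_smul (scaleX_X _)
    (Subtype.ext (by simpa [coe_sξ, coe_sζ] using ξ_mul_ζ q s))
  Y_ι := mul_aeval_of_smul (scaleX_inv_X _)
    (Subtype.ext (by simpa [coe_sη, coe_sζ] using η_mul_ζ q s))
  YX := Subtype.ext (by
    rw [map_neg, map_mul, map_sub, map_one, map_add, map_smul, AlgHom.commutes, aeval_X]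
    exact η_mul_ξ q s)
  XY := Subtype.ext (by
    have h : ((q : k)⁻¹ ^ 2) • scaleX (q ^ 2) (X : k[X]) = X := by
      rw [scaleX_X, smul_smul, Units.val_pow_eq_pow_val, ← mul_pow, inv_mul_cancel₀ q.ne_zero,
        one_pow, one_smul]
    rw [map_neg, map_mul, map_sub, map_one, map_add, map_smul, AlgEquiv.commutes, h, map_neg,
      map_mul, map_sub, map_one, map_add, AlgHom.commutes, aeval_X]
    exact ξ_mul_η q s)

lemma sphereWeyl_subalgebra : (sphereWeyl q s).subalgebra = ⊤ := by
  rw [eq_top_iff]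
  rintro x -
  refine sphere_induction q s (sphereWeyl q s).X_mem (sphereWeyl q s).Y_mem ?_ x
  have := (sphereWeyl q s).ι_mem X
  rwa [show (sphereWeyl q s).ι X = sζ q s from aeval_X _] at this

/-- Taking `l = m` gives `α, β` the same weight and `γ, δ` the inverse one, so the mixed sums `ξ, η,
ζ` are homogeneous for every `s`. -/
lemma torus_ξ : torus q q q (ξ q s) = ((q : k) ^ 2) • ξ q s := by
  simp only [ξ, map_add, map_smul, map_sub, map_mul, map_pow, torus_gen, torusGen, smul_pow,
    smul_mul_assoc, mul_smul_comm]
  match_scalars <;> field_simp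

lemma torus_η : torus q q q (η q s) = ((q : k) ^ 2)⁻¹ • η q s := by
  simp only [η, map_add, map_smul, map_sub, map_mul, map_pow, torus_gen, torusGen, smul_pow,
    smul_mul_assoc, mul_smul_comm]
  match_scalars <;> field_simp

lemma torus_ζ : torus q q q (ζ q s) = ζ q s := by
  simp only [ζ, map_add, map_smul, map_sub, map_mul, map_pow, torus_gen, torusGen, smul_pow,
    smul_mul_assoc, mul_smul_comm, smul_smul, mul_inv_cancel₀ q.ne_zero, inv_mul_cancel₀ q.ne_zero,
    one_smul]

/-- The torus action restricted to the sphere. -/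
def sphereTorus : sphere q s →ₐ[k] sphere q s :=
  ((torus q q q).comp (sphere q s).val).codRestrict (sphere q s) fun x => by
    refine sphere_induction q s (T := (sphere q s).comap
      ((torus q q q).comp (sphere q s).val)) ?_ ?_ ?_ x
    · change torus q q q (ξ q s) ∈ sphere q s
      rw [torus_ξ]; exact Subalgebra.smul_mem _ (sξ q s).2 _
    · change torus q q q (η q s) ∈ sphere q s
      rw [torus_η]; exact Subalgebra.smul_mem _ (sη q s).2 _
    · change torus q q q (ζ q s) ∈ sphere q s
      rw [torus_ζ]; exact (sζ q s).2

variable (hq : ∀ n : ℕ, 0 < n → (q : k) ^ n ≠ 1)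
include hq

/-- The counit sends `ξ` to `s`; for `s = 0`, `ξ` is a multiple of `αβ` in a ring without zero
divisors. -/
lemma ξ_ne_zero : ξ q s ≠ 0 := by
  have := noZeroDivisors q hq
  intro h
  by_cases hs : s = 0
  · subst hs
    simp [ξ, gen_ne_zero] at h
  · exact hs (by simpa [ξ, counitHom_gen, counitGen] using congrArg (counitHom q) h)

lemma η_ne_zero : η q s ≠ 0 := by
  have := noZeroDivisors q hq
  intro h
  by_cases hs : s = 0
  · subst hs
    simp [η, gen_ne_zero] at h
  · exact hs (by simpa [η, counitHom_gen, counitGen] using congrArg (counitHom q) h)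

lemma ζ_ne_zero : ζ q s ≠ 0 := by
  have := noZeroDivisors q hq
  intro h
  by_cases hs : s = 0
  · subst hs
    simp [ζ, gen_ne_zero] at h
  · have h1 := congrArg (torus q q 1) h
    have h2 := congrArg (torus q q 1) h1
    have hq0 : (q : k) ≠ 0 := q.ne_zero
    simp only [ζ, map_add, map_smul, map_sub, map_mul, map_pow, map_zero, torus_gen, torusGen,
      smul_mul_assoc, mul_smul_comm, smul_smul, Units.val_one, inv_one, one_smul, mul_one,
      one_mul] at h h1 h2
    -- The counit kills `ζ`, so weights are used instead. Under `T = torus q q 1` the terms `αγ`,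
    -- `βγ`, `βδ` of `ζ` have weights `q`, `1`, `q⁻¹`; the operator `q (T - 1)(T - q⁻¹)` keeps only
    -- `αγ`.
    have key : ((q : k) * ((q : k) - 1) ^ 2 * (q + 1) * s) • (α q * γ q) = 0 := by
      have h3 := congrArg₂ (fun x y => x + (q : k)⁻¹ • y) h2 h
      have h4 := congrArg₂ (fun x y => x - (1 + (q : k)⁻¹) • y) h3 h1
      have h5 := congrArg (fun x => (q : k) • x) h4
      simp only [smul_zero, sub_zero, add_zero] at h5
      rw [← h5]
      match_scalars <;> field_simp <;> ring
    have e1 : (q : k) - 1 ≠ 0 := fun h => hq 1 one_pos (by rw [pow_one]; exact sub_eq_zero.1 h)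
    have e2 : (q : k) + 1 ≠ 0 := fun h => hq 2 two_pos (by
      rw [eq_neg_of_add_eq_zero_left h]; ring)
    simp [e1, e2, hs, hq0, gen_ne_zero] at key

end
end QSphere
end

/-! ### The cyclic cocycle: construction, trace property, uniqueness -/

noncomputable section
namespace QSphere
open SUq
open scoped Polynomial
open Polynomial (X aeval aeval_X)

section
variable {k : Type*} [Field k] (q : kˣ) (s : k)

/-- The Chern functional on `k[z]`: `z ^ n ↦ (1 - (-s²) ^ n) / (1 - q⁻²ⁿ)`. -/
def chernPoly : k[X] →ₗ[k] k :=
  Polynomial.lsum fun n => ((1 - (-s ^ 2) ^ n) / (1 - ((q : k)⁻¹ ^ 2) ^ n)) • LinearMap.id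

lemma chernPoly_monomial (n : ℕ) (c : k) : chernPoly q s (Polynomial.monomial n c)
    = ((1 - (-s ^ 2) ^ n) / (1 - ((q : k)⁻¹ ^ 2) ^ n)) * c := by
  simp [chernPoly, Polynomial.lsum_apply, Polynomial.sum_monomial_index]

lemma scaleX_inv_monomial (l : kˣ) (n : ℕ) (c : k) :
    (scaleX l)⁻¹ (Polynomial.monomial n c) = Polynomial.monomial n ((l : k)⁻¹ ^ n * c) := by
  rw [← Polynomial.C_mul_X_pow_eq_monomial, map_mul, map_pow, scaleX_inv_X, smul_pow,
    ← Polynomial.algebraMap_eq, AlgEquiv.commutes, Polynomial.algebraMap_eq,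
    mul_smul_comm, Polynomial.C_mul_X_pow_eq_monomial, Polynomial.smul_monomial, smul_eq_mul]

variable (hq : ∀ n : ℕ, 0 < n → (q : k) ^ n ≠ 1)
include hq

lemma one_sub_inv_sq_pow_ne_zero {n : ℕ} (hn : 0 < n) : 1 - ((q : k)⁻¹ ^ 2) ^ n ≠ 0 := by
  rw [sub_ne_zero, ← pow_mul, inv_pow, ne_comm, Ne, inv_eq_one]
  exact hq _ (by omega)

/-- On `zⁿ` the operator `1 - σ⁻¹` is multiplication by `1 - q⁻²ⁿ`, the denominator of `chernPoly`.
For `n = 0` both sides vanish. -/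
lemma chernPoly_sub_scaleX_inv (p : k[X]) :
    chernPoly q s p - chernPoly q s ((scaleX (q ^ 2))⁻¹ p) = p.eval 1 - p.eval (-s ^ 2) := by
  induction p using Polynomial.induction_on' with
  | add p p' h h' =>
    simp only [map_add, Polynomial.eval_add]
    linear_combination h + h'
  | monomial n c =>
    rw [scaleX_inv_monomial, chernPoly_monomial, chernPoly_monomial, Polynomial.eval_monomial,
      Polynomial.eval_monomial]
    rcases n.eq_zero_or_pos with rfl | hn
    · simp
    · have := one_sub_inv_sq_pow_ne_zero q hq hn
      rw [Units.val_pow_eq_pow_val, ← inv_pow]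
      generalize ((q : k)⁻¹ ^ 2) ^ n = t at this ⊢
      field_simp
      ring

lemma isDomain : IsDomain (SUq q) := by
  have := noZeroDivisors q hq
  have : Nontrivial (SUq q) := ⟨⟨_, _, gen_ne_zero q .α⟩⟩
  exact NoZeroDivisors.to_isDomain _

/-- Let `f` be the minimal polynomial, of degree `d`. Moving `ξ` past `f(ζ) = 0` and cancelling it
gives `(σ f)(ζ) = 0`. Then `σ f = q²ᵈ f` by minimality, so `f(0) = 0` as `q²ᵈ ≠ 1`, contradicting `ζ
≠ 0`. -/
lemma isIntegral_ζ_false (h : IsIntegral k (sζ q s)) : False := by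
  have := isDomain q hq
  have hd := minpoly.natDegree_pos h
  set f := minpoly k (sζ q s)
  set d := f.natDegree
  have hz : sζ q s ≠ 0 := fun h => ζ_ne_zero q s hq (congrArg Subtype.val h)
  have hx : sξ q s ≠ 0 := fun h => ξ_ne_zero q s hq (congrArg Subtype.val h)
  have h1 : aeval (sζ q s) (scaleX (q ^ 2) f) = 0 := by
    have := (sphereWeyl q s).X_ι f
    change sξ q s * aeval (sζ q s) f = aeval (sζ q s) (scaleX (q ^ 2) f) * sξ q s at this
    rw [minpoly.aeval, mul_zero] at this
    exact (mul_eq_zero.1 this.symm).resolve_right hx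
  have hcoeff : ∀ (p : k[X]) (n : ℕ),
      (scaleX (q ^ 2) p).coeff n = ((q : k) ^ 2) ^ n * p.coeff n := by
    intro p n
    -- The monomial formula is available for `σ⁻¹`, so the polynomial is written as `σ⁻¹ p`.
    obtain ⟨p, rfl⟩ := (scaleX (q ^ 2))⁻¹.surjective p
    rw [show (scaleX (q ^ 2)) ((scaleX (q ^ 2))⁻¹ p) = p from AlgEquiv.apply_symm_apply _ _]
    induction p using Polynomial.induction_on' with
    | add p p' h h' => simp only [map_add, Polynomial.coeff_add, h, h', mul_add]
    | monomial m c =>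
      rw [scaleX_inv_monomial, Polynomial.coeff_monomial, Polynomial.coeff_monomial]
      split_ifs with hm
      · subst hm
        have := q.ne_zero
        rw [Units.val_pow_eq_pow_val, ← mul_assoc, ← mul_pow,
          mul_inv_cancel₀ (pow_ne_zero 2 this), one_pow, one_mul]
      · simp
  have h2 : f ∣ scaleX (q ^ 2) f - Polynomial.C (((q : k) ^ 2) ^ d) * f := by
    refine minpoly.dvd _ _ ?_
    rw [map_sub, h1, map_mul, minpoly.aeval, mul_zero, sub_zero]
  have h3 : scaleX (q ^ 2) f - Polynomial.C (((q : k) ^ 2) ^ d) * f = 0 := by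
    refine Polynomial.eq_zero_of_dvd_of_degree_lt h2 ?_
    rw [Polynomial.degree_eq_natDegree (minpoly.ne_zero h), Polynomial.degree_lt_iff_coeff_zero]
    intro n hn
    rw [Polynomial.coeff_sub, hcoeff, Polynomial.coeff_C_mul]
    rcases hn.eq_or_lt with rfl | hn
    · exact sub_self _
    · rw [Polynomial.coeff_eq_zero_of_natDegree_lt hn]; ring
  have h4 := congrArg (fun p => Polynomial.coeff p 0) h3
  simp only [Polynomial.coeff_sub, hcoeff, Polynomial.coeff_C_mul, pow_zero, one_mul,
    Polynomial.coeff_zero, ← pow_mul] at h4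
  have h5 : (1 - (q : k) ^ (2 * d)) * f.coeff 0 = 0 := by linear_combination h4
  rcases mul_eq_zero.1 h5 with h6 | h6
  · exact hq (2 * d) (by omega) (sub_eq_zero.1 h6).symm
  · exact hz ((minpoly.coeff_zero_eq_zero h).1 h6)

lemma aeval_sζ_injective : Function.Injective (aeval (R := k) (sζ q s)) := by
  refine transcendental_iff_injective.1 fun h => ?_
  exact isIntegral_ζ_false q s hq h.isIntegral

lemma sphereWeyl_injective : Function.Injective (sphereWeyl q s).normalForm := by
  have := isDomain q hq
  refine (sphereWeyl q s).normalForm_injective (sphereTorus q s) (q ^ 2) ?_ ?_ ?_ ?_ ?_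
  · intro n hn
    rw [Units.val_pow_eq_pow_val, ← pow_mul]
    exact hq _ (by omega)
  · intro r
    change sphereTorus q s (aeval (sζ q s) r) = aeval (sζ q s) r
    rw [← Polynomial.aeval_algHom_apply]
    congr 2
    exact Subtype.ext (torus_ζ q s)
  · exact Subtype.ext ((torus_ξ q s).trans (by rw [Units.val_pow_eq_pow_val]; rfl))
  · exact Subtype.ext ((torus_η q s).trans (by rw [Units.val_pow_eq_pow_val]; rfl))
  · intro n r h
    refine aeval_sζ_injective q s hq ?_
    rw [map_zero]
    refine (mul_eq_zero.1 h).resolve_right ?_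
    obtain ⟨n, rfl | rfl⟩ := n.eq_nat_or_neg
    · exact pow_ne_zero n fun h => ξ_ne_zero q s hq (congrArg Subtype.val h)
    · rw [GenWeyl.mon_neg_natCast]
      exact pow_ne_zero n fun h => η_ne_zero q s hq (congrArg Subtype.val h)

end

section
variable {k : Type*} [Field k] (q : kˣ) (s : k)

lemma sphereWeyl_surjective : Function.Surjective (sphereWeyl q s).normalForm := fun _ =>
  (sphereWeyl q s).mem_subalgebra.1 (sphereWeyl_subalgebra q s ▸ Algebra.mem_top)

variable (hq : ∀ n : ℕ, 0 < n → (q : k) ^ n ≠ 1)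

/-- The cyclic cocycle `τ¹`. -/
def chern : sphere q s →ₗ[k] k :=
  chernPoly q s ∘ₗ Finsupp.lapply 0 ∘ₗ (LinearEquiv.ofBijective (sphereWeyl q s).normalForm
    ⟨sphereWeyl_injective q s hq, sphereWeyl_surjective q s⟩).symm.toLinearMap

lemma chern_normalForm (f : ℤ →₀ k[X]) :
    chern q s hq ((sphereWeyl q s).normalForm f) = chernPoly q s (f 0) := by
  simp only [chern, LinearMap.comp_apply, LinearEquiv.coe_coe]
  rw [show (sphereWeyl q s).normalForm f = LinearEquiv.ofBijective (sphereWeyl q s).normalForm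
    ⟨sphereWeyl_injective q s hq, sphereWeyl_surjective q s⟩ f from rfl,
    LinearEquiv.symm_apply_apply]
  rfl

lemma chern_mon_zero (r : k[X]) : chern q s hq ((sphereWeyl q s).ι r) = chernPoly q s r := by
  have := chern_normalForm q s hq (Finsupp.single 0 r)
  rwa [GenWeyl.normalForm_single, GenWeyl.mon_zero, mul_one, Finsupp.single_eq_same] at this

lemma chern_mon_ne_zero {n : ℤ} (hn : n ≠ 0) (r : k[X]) :
    chern q s hq ((sphereWeyl q s).ι r * (sphereWeyl q s).mon n) = 0 := by
  rw [← GenWeyl.normalForm_single, chern_normalForm, Finsupp.single_eq_of_ne hn.symm, map_zero]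

lemma chern_mul_comm_of_single {y : sphere q s}
    (h : ∀ (n : ℤ) (r : k[X]), chern q s hq ((sphereWeyl q s).ι r * (sphereWeyl q s).mon n * y)
      = chern q s hq (y * ((sphereWeyl q s).ι r * (sphereWeyl q s).mon n))) (x : sphere q s) :
    chern q s hq (x * y) = chern q s hq (y * x) := by
  obtain ⟨f, rfl⟩ := sphereWeyl_surjective q s x
  induction f using Finsupp.induction_linear with
  | zero => simp
  | add f g hf hg => simp only [map_add, add_mul, mul_add, hf, hg]
  | single n r => rw [GenWeyl.normalForm_single, h]

include hq in
-- By `chernPoly_sub_scaleX_inv` the difference of the two sides is `p(1) - p(-s²)` for `p = σ(r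
-- a)`. Both evaluations vanish, since `σ a = -(1 - z)(s² + z)`.
lemma chernPoly_scaleX (r : k[X]) :
    chernPoly q s (scaleX (q ^ 2) (r * (sphereWeyl q s).a))
      = chernPoly q s (r * (sphereWeyl q s).a) := by
  have h := chernPoly_sub_scaleX_inv q s hq (scaleX (q ^ 2) (r * (sphereWeyl q s).a))
  rw [show (scaleX (q ^ 2))⁻¹ (scaleX (q ^ 2) (r * (sphereWeyl q s).a))
    = r * (sphereWeyl q s).a from AlgEquiv.symm_apply_apply _ _] at h
  refine sub_eq_zero.1 (h.trans ?_)
  have hσ : ((q : k)⁻¹ ^ 2) • scaleX (q ^ 2) (X : k[X]) = X := by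
    rw [scaleX_X, smul_smul, Units.val_pow_eq_pow_val, ← mul_pow, inv_mul_cancel₀ q.ne_zero,
      one_pow, one_smul]
  simp only [sphereWeyl, map_mul, map_neg, map_sub, map_one, map_add, map_smul, AlgEquiv.commutes,
    hσ]
  simp only [Polynomial.eval_mul, Polynomial.eval_neg, Polynomial.eval_sub, Polynomial.eval_one,
    Polynomial.eval_X, Polynomial.eval_add, Polynomial.algebraMap_eq, Polynomial.eval_C]
  ring

lemma chern_mul_comm (x y : sphere q s) : chern q s hq (x * y) = chern q s hq (y * x) := by
  let G := sphereWeyl q s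
  -- The `y` that commute with everything under the functional form a subalgebra, so only the three
  -- generators need checking.
  let T : Subalgebra k (sphere q s) :=
    { carrier := {y | ∀ x, chern q s hq (x * y) = chern q s hq (y * x)}
      mul_mem' := fun {y z} hy hz x => by
        rw [← mul_assoc, hz, ← mul_assoc, hy, mul_assoc]
      add_mem' := fun {y z} hy hz x => by
        rw [mul_add, add_mul, map_add, map_add, hy, hz]
      algebraMap_mem' := fun c x => by rw [Algebra.commutes] }
  refine sphere_induction q s (T := T) ?_ ?_ ?_ y x
  · refine chern_mul_comm_of_single q s hq fun n r => ?_
    change chern q s hq (G.ι r * G.mon n * G.X) = chern q s hq (G.X * (G.ι r * G.mon n))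
    -- Only degree `-1` pairs with `ξ` to degree zero. There the two products are `r a` and `σ(r
    -- a)`; in the other degrees both values are zero.
    by_cases hn : n = -1
    · subst hn
      rw [GenWeyl.mon_neg_one, mul_assoc, G.YX, ← mul_assoc, G.X_ι, mul_assoc, G.XY, ← map_mul,
        ← map_mul, ← map_mul, chern_mon_zero, chern_mon_zero]
      exact (chernPoly_scaleX q s hq r).symm
    · obtain ⟨c, -, hc⟩ := G.mon_mul_mon n 1
      obtain ⟨d, -, hd⟩ := G.X_mon n
      rw [GenWeyl.mon_one] at hc
      rw [mul_assoc, hc, ← mul_assoc G.X, G.X_ι, mul_assoc _ G.X, hd, ← mul_assoc, ← mul_assoc,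
        ← map_mul, ← map_mul, chern_mon_ne_zero q s hq (by omega), chern_mon_ne_zero q s hq (by omega)]
  · refine chern_mul_comm_of_single q s hq fun n r => ?_
    change chern q s hq (G.ι r * G.mon n * G.Y) = chern q s hq (G.Y * (G.ι r * G.mon n))
    by_cases hn : n = 1
    · subst hn
      rw [GenWeyl.mon_one, mul_assoc, G.XY, ← mul_assoc, G.Y_ι, mul_assoc, G.YX, ← map_mul,
        ← map_mul, chern_mon_zero, chern_mon_zero]
      -- The two products are `r σ(a)` and `σ⁻¹(r) a`, hence the substitution of `σ⁻¹ r`.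
      have h := chernPoly_scaleX q s hq ((scaleX (q ^ 2))⁻¹ r)
      rw [map_mul, show scaleX (q ^ 2) ((scaleX (q ^ 2))⁻¹ r) = r from
        AlgEquiv.apply_symm_apply _ _] at h
      exact h
    · obtain ⟨c, -, hc⟩ := G.mon_mul_mon n (-1)
      obtain ⟨d, -, hd⟩ := G.Y_mon n
      rw [GenWeyl.mon_neg_one] at hc
      rw [mul_assoc, hc, ← mul_assoc G.Y, G.Y_ι, mul_assoc _ G.Y, hd, ← mul_assoc, ← mul_assoc,
        ← map_mul, ← map_mul, chern_mon_ne_zero q s hq (by omega), chern_mon_ne_zero q s hq (by omega)]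
  · refine chern_mul_comm_of_single q s hq fun n r => ?_
    rw [show sζ q s = G.ι X from (aeval_X _).symm]
    change chern q s hq (G.ι r * G.mon n * G.ι X) = chern q s hq (G.ι X * (G.ι r * G.mon n))
    rw [mul_assoc, G.mon_ι, ← mul_assoc, ← mul_assoc, ← map_mul, ← map_mul]
    by_cases hn : n = 0
    · subst hn
      rw [GenWeyl.mon_zero, mul_one, mul_one, mul_comm]
      rfl
    · rw [chern_mon_ne_zero q s hq hn, chern_mon_ne_zero q s hq hn]

lemma sζ_pow_eq (n : ℕ) : sζ q s ^ n = (sphereWeyl q s).ι (X ^ n) := by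
  change _ = aeval (sζ q s) (X ^ n)
  rw [map_pow, aeval_X]

lemma isChernCocycle_chern : IsChernCocycle q s (chern q s hq) where
  cyclic := chern_mul_comm q s hq
  one := by
    rw [← map_one (sphereWeyl q s).ι, chern_mon_zero, ← Polynomial.monomial_zero_one,
      chernPoly_monomial]
    -- The degree-zero coefficient is `0 / 0`, which is `0` by convention.
    simp
  zeta n _ := by
    rw [sζ_pow_eq, chern_mon_zero, Polynomial.X_pow_eq_monomial, chernPoly_monomial, mul_one]
  zeta_xi n m hm := by
    rw [sζ_pow_eq]
    exact chern_mon_ne_zero q s hq (n := m) (by omega) _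
  zeta_eta n m hm := by
    have := chern_mon_ne_zero q s hq (n := -m) (by omega) (X ^ n)
    rwa [GenWeyl.mon_neg_natCast, ← sζ_pow_eq] at this

lemma IsChernCocycle.ext {q : kˣ} {s : k} {τ τ' : sphere q s →ₗ[k] k} (h : IsChernCocycle q s τ)
    (h' : IsChernCocycle q s τ') : τ = τ' := by
  ext x
  obtain ⟨f, rfl⟩ := sphereWeyl_surjective q s x
  induction f using Finsupp.induction_linear with
  | zero => simp
  | add f g hf hg => simp only [map_add, hf, hg]
  | single n r =>
    rw [GenWeyl.normalForm_single]
    induction r using Polynomial.induction_on' with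
    | add r r' h h' => simp only [map_add, add_mul, h, h']
    | monomial m c =>
      rw [← Polynomial.C_mul_X_pow_eq_monomial, ← Polynomial.smul_eq_C_mul, map_smul,
        ← sζ_pow_eq, smul_mul_assoc, map_smul, map_smul]
      congr 1
      obtain ⟨n, rfl | rfl⟩ := n.eq_nat_or_neg
      · rcases n.eq_zero_or_pos with rfl | hn
        · rw [Nat.cast_zero, GenWeyl.mon_zero, mul_one]
          rcases m.eq_zero_or_pos with rfl | hm
          · rw [pow_zero, h.one, h'.one]
          · rw [h.zeta m hm, h'.zeta m hm]
        · exact (h.zeta_xi m n hn).trans (h'.zeta_xi m n hn).symm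
      · rcases n.eq_zero_or_pos with rfl | hn
        · rw [Nat.cast_zero, neg_zero, GenWeyl.mon_zero, mul_one]
          rcases m.eq_zero_or_pos with rfl | hm
          · rw [pow_zero, h.one, h'.one]
          · rw [h.zeta m hm, h'.zeta m hm]
        · rw [GenWeyl.mon_neg_natCast]
          exact (h.zeta_eta m n hn).trans (h'.zeta_eta m n hn).symm

end
end QSphere
end

/-! ### Traces of idempotents and isomorphic row modules -/

noncomputable section
namespace QSphere
open SUq

section
variable {B : Type*} [Ring B]

lemma vecMul_eq_sum_smul {m n : ℕ} (a : Fin m → B) (f : Matrix (Fin m) (Fin n) B) :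
    Matrix.vecMul a f = ∑ j, a j • f j := by
  ext i
  simp [Matrix.vecMul, dotProduct]

lemma row_mem_rowModule {n : ℕ} (e : Matrix (Fin n) (Fin n) B) (i : Fin n) :
    e i ∈ rowModule e :=
  ⟨Pi.single i 1, by simp [Matrix.single_vecMul, Matrix.row]⟩

lemma vecMul_of_mem_rowModule {n : ℕ} {e : Matrix (Fin n) (Fin n) B} (he : IsIdempotentElem e)
    {v : Fin n → B} (hv : v ∈ rowModule e) : Matrix.vecMul v e = v := by
  obtain ⟨w, rfl⟩ := hv
  rw [Matrix.vecMulLinear_apply, Matrix.vecMul_vecMul, he.eq]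

/-- The matrix of a linear map between the modules of two idempotent matrices. -/
def rowMatrix {n m : ℕ} {e : Matrix (Fin n) (Fin n) B} {f : Matrix (Fin m) (Fin m) B}
    (φ : rowModule e →ₗ[B] rowModule f) : Matrix (Fin n) (Fin m) B :=
  Matrix.of fun i => (φ ⟨e i, row_mem_rowModule e i⟩ : Fin m → B)

/-- A vector `v` of the row module of `f` satisfies `v = v f = ∑ vⱼ fⱼ`, so `φ⁻¹` is right
multiplication by its matrix. Applying this to the vectors `φ(eᵢ)` gives the rows `eᵢ`. -/
lemma rowMatrix_mul {n m : ℕ} {e : Matrix (Fin n) (Fin n) B} {f : Matrix (Fin m) (Fin m) B}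
    (hf : IsIdempotentElem f) (φ : rowModule e ≃ₗ[B] rowModule f) :
    rowMatrix φ.toLinearMap * rowMatrix φ.symm.toLinearMap = e := by
  ext i j
  have h : ∀ v : rowModule f, Matrix.vecMul (v : Fin m → B) (rowMatrix φ.symm.toLinearMap)
      = (φ.symm v : Fin n → B) := by
    intro v
    have hv : v = ∑ j, (v : Fin m → B) j • (⟨f j, row_mem_rowModule f j⟩ : rowModule f) := by
      ext1
      rw [AddSubmonoidClass.coe_finsetSum]
      exact (vecMul_of_mem_rowModule hf v.2).symm.trans (vecMul_eq_sum_smul _ _)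
    conv_rhs => rw [hv]
    rw [vecMul_eq_sum_smul, map_sum, AddSubmonoidClass.coe_finsetSum]
    exact Finset.sum_congr rfl fun j _ => by rw [map_smul]; rfl
  have := congrFun (h (φ ⟨e i, row_mem_rowModule e i⟩)) j
  rw [LinearEquiv.symm_apply_apply] at this
  exact this

/-- By `rowMatrix_mul` in both directions, `e = u v` and `f = v u` for the matrices `u, v` of the
isomorphism and its inverse. -/
lemma trace_eq_of_equiv {k : Type*} [Field k] [Algebra k B] (τ : B →ₗ[k] k)
    (hτ : ∀ x y, τ (x * y) = τ (y * x)) {n m : ℕ} {e : Matrix (Fin n) (Fin n) B}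
    {f : Matrix (Fin m) (Fin m) B} (he : IsIdempotentElem e) (hf : IsIdempotentElem f)
    (φ : rowModule e ≃ₗ[B] rowModule f) : τ e.trace = τ f.trace := by
  have key : ∀ (u : Matrix (Fin n) (Fin m) B) (v : Matrix (Fin m) (Fin n) B),
      τ (u * v).trace = τ (v * u).trace := fun u v => by
    simp only [Matrix.trace, Matrix.diag, Matrix.mul_apply, map_sum]
    rw [Finset.sum_comm]
    exact Finset.sum_congr rfl fun _ _ => Finset.sum_congr rfl fun _ _ => hτ _ _
  have h := key (rowMatrix φ.toLinearMap) (rowMatrix φ.symm.toLinearMap)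
  have h' := rowMatrix_mul he φ.symm
  rw [LinearEquiv.symm_symm] at h'
  rwa [rowMatrix_mul hf φ, h'] at h

/-- The row module of the `1 × 1` identity matrix is free of rank one. -/
def rowModuleOne (B : Type*) [Ring B] :
    rowModule (1 : Matrix (Fin 1) (Fin 1) B) ≃ₗ[B] B :=
  (LinearEquiv.ofTop _ (by
    rw [eq_top_iff]
    exact fun v _ => ⟨v, by simp⟩)).trans (LinearEquiv.funUnique (Fin 1) B B)

end

/-! ### The line bundle, its projector and its charge -/

section
variable {k : Type*} [Field k] (q : kˣ) (s : k)

/-- The column `(α + sβ, γ + sδ)`. -/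
def colVec : Fin 2 → SUq q := ![col₁ q s, col₂ q s]
/-- The row `(δ - qsγ, sα - q⁻¹β)`. -/
def rowVec : Fin 2 → SUq q := ![row₁ q s, row₂ q s]

lemma coe_projector (i j : Fin 2) :
    (projector q s i j : SUq q) = (1 + s ^ 2)⁻¹ • (colVec q s i * rowVec q s j) := by
  fin_cases i <;> fin_cases j <;>
  simp [projector, colVec, rowVec, col₁_row₁, col₁_row₂, col₂_row₁, col₂_row₂, coe_sξ, coe_sη,
    coe_sζ]

lemma coe_vecMul_projector (v : Fin 2 → sphere q s) (j : Fin 2) :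
    ((Matrix.vecMul v (projector q s) j : sphere q s) : SUq q)
      = (1 + s ^ 2)⁻¹ • ((∑ i, v i • colVec q s i) * rowVec q s j) := by
  simp only [Matrix.vecMul, dotProduct, Fin.sum_univ_two, Subalgebra.coe_add, Subalgebra.coe_mul,
    coe_projector, add_mul, Subalgebra.smul_def, smul_eq_mul, mul_smul_comm, smul_add, mul_assoc]

lemma trace_projector (hs : 1 + s ^ 2 ≠ 0) : (projector q s).trace
    = 1 - ((1 + s ^ 2)⁻¹ * (1 - (q : k)⁻¹ ^ 2)) • sζ q s := by
  rw [Matrix.trace_fin_two]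
  simp only [projector, Matrix.smul_apply, Matrix.of_apply, Matrix.cons_val', Matrix.cons_val_zero,
    Matrix.cons_val_one, Matrix.cons_val_fin_one, Algebra.algebraMap_eq_smul_one]
  match_scalars <;> field_simp
  ring

lemma lineBundle_eq_span : lineBundle q s = Submodule.span (sphere q s) (Set.range (colVec q s)) := by
  rw [colVec, Matrix.range_cons, Matrix.range_cons, Matrix.range_empty, Set.union_empty]
  rfl

variable (hs : 1 + s ^ 2 ≠ 0)
include hs

lemma sum_mul_rowVec (x : SUq q) :
    (1 + s ^ 2)⁻¹ • ∑ j, x * rowVec q s j * colVec q s j = x := by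
  simp only [Fin.sum_univ_two, rowVec, colVec, Matrix.cons_val_zero, Matrix.cons_val_one,
    mul_assoc, ← mul_add, row_col, Matrix.cons_val_fin_one]
  rw [← Algebra.commutes, ← Algebra.smul_def, smul_smul, inv_mul_cancel₀ hs, one_smul]

lemma sum_vecMul_smul_colVec (v : Fin 2 → sphere q s) :
    ∑ j, Matrix.vecMul v (projector q s) j • colVec q s j = ∑ i, v i • colVec q s i := by
  conv_rhs => rw [← sum_mul_rowVec q s hs (∑ i, v i • colVec q s i), Finset.smul_sum]
  refine Finset.sum_congr rfl fun j _ => ?_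
  rw [Subalgebra.smul_def, coe_vecMul_projector, smul_eq_mul, smul_mul_assoc]

lemma isIdempotentElem_projector : IsIdempotentElem (projector q s) := by
  ext i j
  change ((Matrix.vecMul (projector q s i) (projector q s) j : sphere q s) : SUq q) = _
  have h : ∑ l, projector q s i l • colVec q s l = colVec q s i := by
    simp only [Subalgebra.smul_def, smul_eq_mul, coe_projector, smul_mul_assoc]
    rw [← Finset.smul_sum, sum_mul_rowVec q s hs]
  rw [coe_vecMul_projector, h, coe_projector]

/-- `B² e_s ≅ E_s`. -/
lemma nonempty_rowModule_projector_equiv :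
    Nonempty (rowModule (projector q s) ≃ₗ[sphere q s] lineBundle q s) := by
  let V : (Fin 2 → sphere q s) →ₗ[sphere q s] SUq q :=
    Fintype.linearCombination (sphere q s) (colVec q s)
  have hV : ∀ v, V (Matrix.vecMul v (projector q s)) = V v := fun v => by
    simpa [V, Fintype.linearCombination_apply] using sum_vecMul_smul_colVec q s hs v
  let W := V ∘ₗ (rowModule (projector q s)).subtype
  have hinj : Function.Injective W := by
    rw [injective_iff_map_eq_zero]
    rintro ⟨_, v, rfl⟩ h
    have h' : V v = 0 := (hV v).symm.trans h
    -- The entries of `v e_s` are `(1 + s²)⁻¹ (v · column) rowⱼ`, so they vanish with `v · column`.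
    ext j
    change ((Matrix.vecMul v (projector q s) j : sphere q s) : SUq q) = 0
    rw [coe_vecMul_projector, ← Fintype.linearCombination_apply, show
      Fintype.linearCombination (sphere q s) (colVec q s) v = 0 from h', zero_mul, smul_zero]
  have hrange : LinearMap.range W = lineBundle q s := by
    rw [lineBundle_eq_span, ← Fintype.range_linearCombination]
    apply le_antisymm
    · rintro _ ⟨w, rfl⟩
      exact ⟨w, rfl⟩
    · rintro _ ⟨v, rfl⟩
      exact ⟨⟨_, v, rfl⟩, hV v⟩
  exact ⟨(LinearEquiv.ofInjective W hinj).trans (LinearEquiv.ofEq _ _ hrange)⟩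

omit hs

/-! ### The charge one elements -/

/-- Expand `(1 + s²) col₂ = col₂ (row · column)` as `-η col₁ + (s² + q⁻² ζ) col₂` and apply `π_s`,
under which left multiplication by `η` and `ζ` becomes `-s` and `0`. Consequently both column
entries coact through the same group-like element. -/
lemma π_col₂ : π q s (col₂ q s) = s • π q s (col₁ q s) := by
  have h : algebraMap k _ (1 + s ^ 2) * col₂ q s
      = col₂ q s * row₁ q s * col₁ q s + col₂ q s * row₂ q s * col₂ q s := by
    rw [mul_assoc, mul_assoc, ← mul_add, row_col, Algebra.commutes]
  rw [col₂_row₁, col₂_row₂, add_mul, ← Algebra.smul_def, ← Algebra.smul_def, smul_mul_assoc,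
    neg_mul] at h
  have h' := congrArg (π q s) h
  simp only [map_add, map_smul, map_neg, π_η_mul, π_ζ_mul, smul_zero, add_zero, neg_neg] at h'
  rw [add_smul, one_smul] at h'
  exact add_right_cancel h'

lemma coact_col₁ : coact q s (col₁ q s) = col₁ q s ⊗ₜ π q s (col₁ q s) := by
  rw [coact, LinearMap.comp_apply, comul_eq, comul_col₁, map_add, LinearMap.lTensor_tmul,
    LinearMap.lTensor_tmul, π_col₂ q s, ← TensorProduct.smul_tmul, ← TensorProduct.add_tmul]
  rfl

lemma coact_col₂ : coact q s (col₂ q s) = col₂ q s ⊗ₜ π q s (col₁ q s) := by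
  rw [coact, LinearMap.comp_apply, comul_eq, comul_col₂, map_add, LinearMap.lTensor_tmul,
    LinearMap.lTensor_tmul, π_col₂ q s, ← TensorProduct.smul_tmul, ← TensorProduct.add_tmul]
  rfl

lemma comul_π_col₁ : Coalgebra.comul (R := k) (π q s (col₁ q s))
    = π q s (col₁ q s) ⊗ₜ π q s (col₁ q s) := by
  change (π q s).rTensor _ (coact q s (col₁ q s)) = _
  rw [coact_col₁ q s, LinearMap.rTensor_tmul]

lemma coact_of_mem_lineBundle {p : SUq q} (hp : p ∈ lineBundle q s) :
    coact q s p = p ⊗ₜ π q s (col₁ q s) := by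
  induction hp using Submodule.span_induction with
  | mem x hx =>
    rcases hx with rfl | rfl
    · exact coact_col₁ q s
    · exact coact_col₂ q s
  | zero => simp
  | add x y _ _ hx hy => rw [map_add, hx, hy, TensorProduct.add_tmul]
  | smul b x _ hx => rw [coact_smul, hx]; rfl

lemma tmul_one_mem_associatedModule {p : SUq q} :
    p ⊗ₜ[k] (1 : k) ∈ associatedModule q s (leftCoact q s)
      ↔ coact q s p = p ⊗ₜ π q s (col₁ q s) := by
  let F : SUq q ⊗[k] C q s ≃ₗ[k] SUq q ⊗[k] (C q s ⊗[k] k) :=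
    (TensorProduct.rid k _).symm.trans (TensorProduct.assoc k _ _ _)
  change F (coact q s p) = F (p ⊗ₜ π q s (col₁ q s)) ↔ _
  exact F.injective.eq_iff

/-- Right multiplication on `C_s`. -/
def mulRightC (b : SUq q) : C q s →ₗ[k] C q s :=
  (J q s).mapQ (J q s) (LinearMap.mulRight k b) (by
    refine Submodule.span_le.2 ?_
    rintro _ ⟨c, hc, p, rfl⟩
    exact Submodule.subset_span ⟨c, hc, p * b, mul_assoc _ _ _⟩)

lemma mulRightC_π (b x : SUq q) : mulRightC q s b (π q s x) = π q s (x * b) := rfl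

/-- `J_s` is a right ideal, so `C_s` is a right `SU_q(2)`-module and the coaction on `y` determines
the one on `y p`. -/
lemma coact_mul_of_coact {y g : SUq q} (hy : coact q s y = y ⊗ₜ π q s g) (p : SUq q) :
    coact q s (y * p) = TensorProduct.map (LinearMap.mulLeft k y)
      (π q s ∘ₗ LinearMap.mulLeft k g) (comulHom q p) := by
  rw [coact, LinearMap.comp_apply, comul_eq, map_mul]
  induction comulHom q p with
  | zero => simp
  | add t t' h h' => simp only [mul_add, map_add, h, h']
  | tmul a b =>
    have key : ∀ t : SUq q ⊗[k] SUq q, (π q s).lTensor (SUq q) (t * (a ⊗ₜ b))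
        = TensorProduct.map (LinearMap.mulRight k a) (mulRightC q s b)
          ((π q s).lTensor (SUq q) t) := by
      intro t
      induction t with
      | zero => simp
      | add t t' h h' => simp only [add_mul, map_add, h, h']
      | tmul c d => simp [mulRightC_π]
    rw [key]
    change TensorProduct.map (LinearMap.mulRight k a) (mulRightC q s b) (coact q s y) = _
    rw [hy]
    simp [mulRightC_π]

lemma π_col₁_row₁ : π q s (col₁ q s * row₁ q s) = π q s 1 := by
  have := π_ζ_mul q s 1
  rw [mul_one] at this
  rw [col₁_row₁, map_sub, this, sub_zero]

lemma π_col₁_row₂ : π q s (col₁ q s * row₂ q s) = s • π q s 1 := by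
  rw [col₁_row₂, ← π_ξ_mul, mul_one]

/-- The row carries the opposite charge: `π_s(col₁ row₁) = π_s(1)` and `π_s(col₁ row₂) = s π_s(1)`.
-/
lemma coact_mul_rowVec {p : SUq q} (hp : coact q s p = p ⊗ₜ π q s (col₁ q s)) (i : Fin 2) :
    coact q s (p * rowVec q s i) = (p * rowVec q s i) ⊗ₜ π q s 1 := by
  rw [coact_mul_of_coact q s hp]
  fin_cases i
  · change TensorProduct.map _ _ (comulHom q (row₁ q s)) = (p * row₁ q s) ⊗ₜ π q s 1
    have e : p * row₁ q s = p * δ q - ((q : k) * s) • (p * γ q) := by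
      rw [row₁, mul_sub, mul_smul_comm]
    rw [comul_row₁, e]
    simp only [map_sub, map_smul, TensorProduct.map_tmul, LinearMap.mulLeft_apply,
      LinearMap.comp_apply, π_col₁_row₁, π_col₁_row₂,
      TensorProduct.sub_tmul, TensorProduct.tmul_smul, ← TensorProduct.smul_tmul', smul_smul]
  · change TensorProduct.map _ _ (comulHom q (row₂ q s)) = (p * row₂ q s) ⊗ₜ π q s 1
    rw [comul_row₂]
    simp only [map_sub, map_smul, TensorProduct.map_tmul, LinearMap.mulLeft_apply,
      LinearMap.comp_apply, π_col₁_row₁, π_col₁_row₂, TensorProduct.tmul_smul]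
    rw [row₂, mul_sub, mul_smul_comm, mul_smul_comm, TensorProduct.sub_tmul,
      ← TensorProduct.smul_tmul', ← TensorProduct.smul_tmul']

/-- If the elements of charge one are the multiples of a single one, then `E_s` is free. -/
lemma nonempty_lineBundle_equiv (hq : ∀ n : ℕ, 0 < n → (q : k) ^ n ≠ 1) (hs : 1 + s ^ 2 ≠ 0)
    {p : SUq q} (hp : coact q s p = p ⊗ₜ π q s (col₁ q s))
    (hgen : ∀ x, coact q s x = x ⊗ₜ π q s (col₁ q s) → ∃ b : sphere q s, x = b • p) :
    Nonempty (lineBundle q s ≃ₗ[sphere q s] sphere q s) := by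
  have := isDomain q hq
  obtain ⟨b₁, h₁⟩ := hgen _ (coact_col₁ q s)
  obtain ⟨b₂, h₂⟩ := hgen _ (coact_col₂ q s)
  have hp0 : p ≠ 0 := by
    rintro rfl
    have h := row_col q s
    rw [h₁, h₂, smul_zero, smul_zero, mul_zero, mul_zero, add_zero] at h
    exact hs ((map_eq_zero_iff _ (algebraMap k (SUq q)).injective).1 h.symm)
  -- Here `p rowᵢ` is only known to be coinvariant. But `p rowᵢ p` then has charge one, hence equals
  -- some `b p`, and cancelling `p` gives `p rowᵢ = b ∈ B`.
  have hmem : ∀ i, p * rowVec q s i ∈ sphere q s := by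
    intro i
    obtain ⟨b, hb⟩ := hgen (p * rowVec q s i * p) (by
      have h1 : LinearMap.mulLeft k (1 : SUq q) = LinearMap.id := by ext; simp
      rw [coact_mul_of_coact q s (coact_mul_rowVec q s hp i), h1, LinearMap.comp_id]
      rw [← LinearMap.rTensor_comp_lTensor, LinearMap.comp_apply]
      change LinearMap.rTensor _ _ (coact q s p) = _
      rw [hp, LinearMap.rTensor_tmul, LinearMap.mulLeft_apply])
    rw [mul_right_cancel₀ hp0 (hb.trans (by rw [Subalgebra.smul_def, smul_eq_mul]))]
    exact b.2
  have hspan : Submodule.span (sphere q s) {p} = lineBundle q s := by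
    apply le_antisymm
    · rw [Submodule.span_singleton_le_iff_mem, ← sum_mul_rowVec q s hs p, Finset.smul_sum]
      refine Submodule.sum_mem _ fun j _ => ?_
      rw [← smul_mul_assoc]
      have hc : colVec q s j ∈ lineBundle q s := by
        rw [lineBundle_eq_span]; exact Submodule.subset_span ⟨j, rfl⟩
      exact (lineBundle q s).smul_mem (⟨_, (sphere q s).smul_mem (hmem j) _⟩ : sphere q s) hc
    · refine Submodule.span_le.2 ?_
      rintro _ (h | h)
      · exact Submodule.mem_span_singleton.2 ⟨b₁, h₁.symm.trans h.symm⟩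
      · exact Submodule.mem_span_singleton.2 ⟨b₂, h₂.symm.trans h.symm⟩
  have hinj : Function.Injective (LinearMap.toSpanSingleton (sphere q s) (SUq q) p) := by
    intro x y hxy
    exact Subtype.ext (mul_right_cancel₀ hp0 hxy)
  exact ⟨((LinearEquiv.ofInjective _ hinj).trans (LinearEquiv.ofEq _ _
    ((LinearMap.range_toSpanSingleton p).trans hspan))).symm⟩

/-- The charge-one elements are `E'_s` after `P ⊗ k ≅ P`, so the preimage of `1` under the given
isomorphism generates them. -/
lemma nonempty_lineBundle_equiv_of_associatedModule (hq : ∀ n : ℕ, 0 < n → (q : k) ^ n ≠ 1)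
    (hs : 1 + s ^ 2 ≠ 0)
    (e : associatedModule q s (leftCoact q s) ≃ₗ[sphere q s] sphere q s ⊗[k] k) :
    Nonempty (lineBundle q s ≃ₗ[sphere q s] sphere q s) := by
  let R := TensorProduct.AlgebraTensorModule.rid k (sphere q s) (SUq q)
  let e' := e.trans (TensorProduct.AlgebraTensorModule.rid k (sphere q s) (sphere q s))
  have hR : ∀ x : SUq q ⊗[k] k, x = R x ⊗ₜ 1 := fun x => (R.symm_apply_apply x).symm
  refine nonempty_lineBundle_equiv q s hq hs (p := R (e'.symm 1)) ?_ ?_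
  · rw [← tmul_one_mem_associatedModule, ← hR]
    exact (e'.symm 1).2
  · intro x hx
    rw [← tmul_one_mem_associatedModule] at hx
    refine ⟨e' ⟨_, hx⟩, ?_⟩
    have h := e'.symm.map_smul (e' ⟨_, hx⟩) 1
    rw [smul_eq_mul, mul_one, e'.symm_apply_apply] at h
    have h' := congrArg (fun y => R (Subtype.val y)) h
    exact (one_smul k x).symm.trans (h'.trans (R.map_smul _ _))

/-- With `g = π_s(α + sβ)` group-like, the charge-one elements of `B ⊗ C_s` are `B ⊗ g`, so `θ⁻¹(1 ⊗
g)` is the generator. -/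
lemma nonempty_lineBundle_equiv_of_isCleft (hq : ∀ n : ℕ, 0 < n → (q : k) ^ n ≠ 1)
    (hs : 1 + s ^ 2 ≠ 0) (h : IsCleft q s) :
    Nonempty (lineBundle q s ≃ₗ[sphere q s] sphere q s) := by
  obtain ⟨θ, hθ⟩ := h
  set g := π q s (col₁ q s)
  have hΔ : Coalgebra.comul (R := k) g = g ⊗ₜ g := comul_π_col₁ q s
  have hε : Coalgebra.counit (R := k) g = 1 := by
    change counitHom q (col₁ q s) = 1
    simp [col₁, counitHom_gen, counitGen]
  refine nonempty_lineBundle_equiv q s hq hs (p := θ.symm (1 ⊗ₜ g)) ?_ ?_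
  · have h1 := hθ (θ.symm (1 ⊗ₜ g))
    rw [θ.apply_symm_apply, LinearMap.lTensor_tmul, hΔ] at h1
    have hinj : Function.Injective
        ((θ.toLinearMap.restrictScalars k).rTensor (C q s)) :=
      Module.Flat.rTensor_preserves_injective_linearMap _ θ.injective
    apply hinj
    apply (TensorProduct.assoc k (sphere q s) (C q s) (C q s)).injective
    rw [h1, LinearMap.rTensor_tmul]
    change _ = TensorProduct.assoc k _ _ _ (θ (θ.symm (1 ⊗ₜ g)) ⊗ₜ g)
    rw [θ.apply_symm_apply]
    rfl
  · intro x hx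
    have h1 := hθ x
    rw [hx, LinearMap.rTensor_tmul] at h1
    change TensorProduct.assoc k _ _ _ (θ x ⊗ₜ g) = _ at h1
    let E : sphere q s ⊗[k] C q s →ₗ[k] sphere q s :=
      (TensorProduct.rid k _).toLinearMap ∘ₗ (Coalgebra.counit (R := k)).lTensor _
    refine ⟨E (θ x), ?_⟩
    rw [← map_smul, θ.eq_symm_apply, TensorProduct.smul_tmul', smul_eq_mul, mul_one]
    -- Apply the counit to the middle leg of `θ(x) ⊗ g = (id ⊗ Δ) θ(x)`; this gives `θ(x) = E(θ(x))
    -- ⊗ g`.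
    have h2 := congrArg (((TensorProduct.lid k (C q s)).toLinearMap ∘ₗ
      (Coalgebra.counit (R := k)).rTensor _).lTensor (sphere q s)) h1
    have h3 : ∀ t : sphere q s ⊗[k] C q s, (((TensorProduct.lid k (C q s)).toLinearMap ∘ₗ
        (Coalgebra.counit (R := k)).rTensor _).lTensor (sphere q s))
          (TensorProduct.assoc k _ _ _ (t ⊗ₜ g)) = E t ⊗ₜ g := by
      intro t
      induction t with
      | zero => simp
      | add t t' h h' => simp only [TensorProduct.add_tmul, map_add, h, h']
      | tmul b c => simp [E, TensorProduct.smul_tmul]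
    have h4 : ∀ t : sphere q s ⊗[k] C q s, (((TensorProduct.lid k (C q s)).toLinearMap ∘ₗ
        (Coalgebra.counit (R := k)).rTensor _).lTensor (sphere q s))
          ((Coalgebra.comul (R := k) (A := C q s)).lTensor (sphere q s) t) = t := by
      intro t
      induction t with
      | zero => simp
      | add t t' h h' => simp only [map_add, h, h']
      | tmul b c => simp
    rw [h3, h4] at h2
    exact h2.symm

/-- A free module of rank one is the row module of the `1 × 1` identity, whose trace `1` is killed
by `τ`. -/
lemma not_nonempty_lineBundle_equiv (hs : 1 + s ^ 2 ≠ 0)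
    {τ : sphere q s →ₗ[k] k} (hτ : IsChernCocycle q s τ)
    (h : τ (projector q s).trace ≠ 0) :
    ¬ Nonempty (lineBundle q s ≃ₗ[sphere q s] sphere q s) := by
  rintro ⟨e⟩
  obtain ⟨f⟩ := nonempty_rowModule_projector_equiv q s hs
  have h1 := trace_eq_of_equiv τ hτ.cyclic (isIdempotentElem_projector q s hs) .one
    ((f.trans e).trans (rowModuleOne _).symm)
  rw [Matrix.trace_fin_one, Matrix.one_apply_eq, hτ.one] at h1
  exact h h1

lemma chern_trace_projector (hq : ∀ n : ℕ, 0 < n → (q : k) ^ n ≠ 1) (hs : 1 + s ^ 2 ≠ 0)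
    {τ : sphere q s →ₗ[k] k} (hτ : IsChernCocycle q s τ) : τ (projector q s).trace = -1 := by
  have hζ := hτ.zeta 1 one_pos
  have h1 := one_sub_inv_sq_pow_ne_zero q hq one_pos
  simp only [pow_one] at hζ h1
  rw [trace_projector q s hs, map_sub, map_smul, hτ.one, hζ, smul_eq_mul]
  generalize (q : k)⁻¹ ^ 2 = t at h1 ⊢
  field_simp
  ring

end
end QSphere
end

theorem mainTheorem2 {k : Type*} [RCLike k] (q : kˣ) (hq : ∀ n : ℕ, 0 < n → (q : k) ^ n ≠ 1)
    (s : ℝ) (hs : s ∈ Set.Icc (0 : ℝ) 1) :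
    ∃ τ : QSphere.sphere q (s : k) →ₗ[k] k,
      (QSphere.IsChernCocycle q (s : k) τ ∧
        ∀ τ' : QSphere.sphere q (s : k) →ₗ[k] k, QSphere.IsChernCocycle q (s : k) τ' → τ' = τ) ∧
      τ 1 = 0 ∧
      τ (QSphere.sζ q (s : k)) = (1 + (s : k) ^ 2) / (1 - (q : k)⁻¹ ^ 2) ∧
      IsIdempotentElem (QSphere.projector q (s : k)) ∧
      Nonempty (QSphere.rowModule (QSphere.projector q (s : k)) ≃ₗ[QSphere.sphere q (s : k)]
        QSphere.lineBundle q (s : k)) ∧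
      τ (Matrix.trace (QSphere.projector q (s : k))) = -1 ∧
      (∀ (n : ℕ) (f : Matrix (Fin n) (Fin n) (QSphere.sphere q (s : k))), IsIdempotentElem f →
        Nonempty (QSphere.rowModule f ≃ₗ[QSphere.sphere q (s : k)]
          QSphere.lineBundle q (s : k)) →
        τ (Matrix.trace f) = -1) ∧
      (∀ p ∈ QSphere.lineBundle q (s : k), p ⊗ₜ[k] (1 : k) ∈
        QSphere.associatedModule q (s : k) (QSphere.leftCoact q (s : k))) ∧
      ¬ Nonempty (QSphere.lineBundle q (s : k) ≃ₗ[QSphere.sphere q (s : k)]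
        QSphere.sphere q (s : k) ⊗[k] k) ∧
      ¬ Nonempty (QSphere.associatedModule q (s : k) (QSphere.leftCoact q (s : k))
        ≃ₗ[QSphere.sphere q (s : k)] QSphere.sphere q (s : k) ⊗[k] k) ∧
      ¬ QSphere.IsCleft q (s : k) := by
  have hs' : 1 + (s : k) ^ 2 ≠ 0 := by
    -- Reality of `s` matters when `k = ℂ`, where `1 + s²` could otherwise vanish.
    have h : (1 + s ^ 2 : ℝ) ≠ 0 := by positivity
    exact_mod_cast (RCLike.ofReal_ne_zero (K := k)).2 h
  have hτ := QSphere.isChernCocycle_chern q (s : k) hq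
  have htr := QSphere.chern_trace_projector q (s : k) hq hs' hτ
  have hE := QSphere.not_nonempty_lineBundle_equiv q (s : k) hs' hτ (by rw [htr]; simp)
  have hid := QSphere.isIdempotentElem_projector q (s : k) hs'
  obtain ⟨φ⟩ := QSphere.nonempty_rowModule_projector_equiv q (s : k) hs'
  refine ⟨QSphere.chern q s hq, ⟨hτ, fun τ' h => h.ext hτ⟩, hτ.one, ?_, hid, ⟨φ⟩, htr, ?_, ?_,
    ?_, ?_, ?_⟩
  · simpa using hτ.zeta 1 one_pos
  · rintro n f hf ⟨e⟩
    rw [QSphere.trace_eq_of_equiv _ hτ.cyclic hf hid (e.trans φ.symm), htr]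
  · exact fun p hp => (QSphere.tmul_one_mem_associatedModule q (s : k)).2
      (QSphere.coact_of_mem_lineBundle q (s : k) hp)
  · exact fun ⟨e⟩ => hE ⟨e.trans (TensorProduct.AlgebraTensorModule.rid k _ _)⟩
  · exact fun ⟨e⟩ =>
      hE (QSphere.nonempty_lineBundle_equiv_of_associatedModule q (s : k) hq hs' e)
  · exact fun h => hE (QSphere.nonempty_lineBundle_equiv_of_isCleft q (s : k) hq hs' h)
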